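/- A permutation is an arrangement of $1,2,\dots,n$ for some $n\geqslant 1$ (the empty permutation is not counted). A permutation $\sigma$ contains $\tau$ if some subsequence of $\sigma$ is order isomorphic to $\tau$, and avoids $\tau$ otherwise. Let $\mathrm{Av}_n(1234,2341)$ be the set of permutations of length $n$ that avoid both $1234$ and $2341$. Then the generating function $F(z)=\sum_{n\geqslant 1}|\mathrm{Av}_n(1234,2341)|\,z^n$ is algebraic (it satisfies $P(z,F(z))=0$ for some nonzero polynomial $P(z,y)$ over $\mathbb{Q}$), and, as a formal power series, $$ F(z)=\frac{2-10z+9z^2+7z^3-4z^4-(2-8z+9z^2-3z^3)\sqrt{1-4z}}{(1-3z+z^2)\big((1-5z+4z^2)+(1-3z)\sqrt{1-4z}\big)}, $$ where $\sqrt{1-4z}$ is the power series with constant term $1$ whose square is $1-4z$. Moreover the growth rate of the class exists and equals $4$: $\lim_{n\to\infty}|\mathrm{Av}_n(1234,2341)|^{1/n}=4$. -/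

import Mathlib

open Filter Topology
open scoped PowerSeries

namespace PermPattern

/-- A permutation together with its length: `⟨n, σ⟩` is the permutation `σ` of length `n`, in
which positions and values are numbered from `0` instead of from `1`. -/
abbrev SizedPerm : Type := Σ n : ℕ, Equiv.Perm (Fin n)

/-- `Contains τ σ`: some subsequence of `σ`, read from left to right, is order isomorphic
to `τ`. -/
def Contains (τ σ : SizedPerm) : Prop :=
  ∃ f : Fin τ.1 ↪o Fin σ.1, ∀ i j : Fin τ.1, τ.2 i < τ.2 j ↔ σ.2 (f i) < σ.2 (f j)

/-- `Av(B)`: the permutations of positive length that contain no element of `B`. -/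
def Av (B : Set SizedPerm) : Set SizedPerm :=
  {σ | 0 < σ.1 ∧ ∀ τ ∈ B, ¬ Contains τ σ}

/-- The number of elements of length `n` in a set of permutations. -/
noncomputable def count (C : Set SizedPerm) (n : ℕ) : ℕ :=
  {σ : Equiv.Perm (Fin n) | (⟨n, σ⟩ : SizedPerm) ∈ C}.ncard

/-- The ordinary generating function of a set of permutations, by length. -/
noncomputable def genFun (C : Set SizedPerm) : ℚ⟦X⟧ :=
  PowerSeries.mk fun n => (count C n : ℚ)

/-- `C` has growth rate `γ`: the limit of `|Cₙ| ^ (1 / n)` exists and equals `γ`. -/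
def HasGrowthRate (C : Set SizedPerm) (γ : ℝ) : Prop :=
  Tendsto (fun n : ℕ => (count C n : ℝ) ^ (1 / (n : ℝ))) atTop (𝓝 γ)

/-- The permutation `1234` (one-line notation). -/
def p1234 : SizedPerm := ⟨4, ![0, 1, 2, 3], ![0, 1, 2, 3], by decide, by decide⟩

/-- The permutation `2341` (one-line notation); the second vector is the inverse. -/
def p2341 : SizedPerm := ⟨4, ![1, 2, 3, 0], ![3, 0, 1, 2], by decide, by decide⟩

/-- The formal power series `√(1 - 4z) = (1 + (-4z)) ^ (1/2)`, by the binomial expansion. -/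
noncomputable def sqrtOneSubFour : ℚ⟦X⟧ :=
  PowerSeries.rescale (-4 : ℚ) (PowerSeries.binomialSeries ℚ (1 / 2 : ℚ))

theorem sqrtOneSubFour_sq : sqrtOneSubFour ^ 2 = 1 - 4 * PowerSeries.X := by
  have h : (PowerSeries.binomialSeries ℚ (1 / 2 : ℚ)) ^ 2 = 1 + PowerSeries.X := by
    rw [sq, ← PowerSeries.binomialSeries_add]
    have := PowerSeries.binomialSeries_nat (R := ℚ) (A := ℚ) 1
    norm_num at this ⊢
    exact this
  rw [sqrtOneSubFour, ← map_pow, h, map_add, map_one, PowerSeries.rescale_X]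
  simp only [map_neg, map_ofNat]
  ring

theorem constantCoeff_sqrtOneSubFour : PowerSeries.constantCoeff sqrtOneSubFour = 1 := by
  rw [sqrtOneSubFour, ← PowerSeries.coeff_zero_eq_constantCoeff_apply, PowerSeries.coeff_rescale]
  simp

/-- The numerator of the claimed generating function. -/
noncomputable def numer : ℚ⟦X⟧ :=
  let z : ℚ⟦X⟧ := PowerSeries.X
  (2 - 10 * z + 9 * z ^ 2 + 7 * z ^ 3 - 4 * z ^ 4)
    - (2 - 8 * z + 9 * z ^ 2 - 3 * z ^ 3) * sqrtOneSubFour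

/-- The denominator of the claimed generating function. -/
noncomputable def denom : ℚ⟦X⟧ :=
  let z : ℚ⟦X⟧ := PowerSeries.X
  (1 - 3 * z + z ^ 2) * ((1 - 5 * z + 4 * z ^ 2) + (1 - 3 * z) * sqrtOneSubFour)

/-- The denominator is an invertible power series, so that `denom⁻¹` is its true inverse. -/
theorem constantCoeff_denom : PowerSeries.constantCoeff denom = 2 := by
  simp [denom, constantCoeff_sqrtOneSubFour]
  norm_num

end PermPattern

/-! Permutations are grown from right to left by prepending a first entry `v`. The future of a
permutation depends only on its length, the number `k` of largest values that stand in decreasing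
order, the least entry `a` to the right of the maximum, and the set of active sites (`Tracks`).
Prepending at a site with an ascending pair above it destroys every site up to `v`. Prepending `v <
n` elsewhere destroys only the sites in `(a, v]`. A new maximum destroys none.

Only the cardinalities of certain sets of sites matter in the end, which gives a generating tree
with three families of labels (`siteCount_eq_labelCount`): decreasing permutations (`dec`),
permutations with `a ≥ n - k` (`mid`) and the others (`gen`). The flag `f` says whether site `0` is
active.

The tree below `gen false m 0 q` is a Catalan tree with series `C ^ (m + q + 2)`. The other subtree
series obey linear recurrences in their parameters. Summing these with weights `w ^ l` and choosing
`w` as a root of the kernel, either `w - X` or `w - w ^ 2 - X`, removes the unwanted sums; the roots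
are `X` and `X * C`. What remains is a triangular linear system over the fraction field, where `X =
(C - 1) / C ^ 2`, so the answer is rational in `C` (`kernel_system_solution`). The stated form
follows from `√(1 - 4X) = 1 - 2 * X * C`.

For the growth rate, clearing `C` from the denominator leaves `(1 - 4X)(1 - 3X + X²)`, so the counts
are at most a polynomial times `4 ^ n`. A Catalan subtree at depth `4` gives the matching lower
bound. -/

namespace PermPattern

/-! ### Prepending an entry, and active sites. -/

/-- The shift of the value `x` caused by inserting a new value `v`. -/
def bump (v x : ℕ) : ℕ := if v ≤ x then x + 1 else x

/-- Prepend the entry `v` to the permutation `σ`, shifting the values that are at least `v`. -/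
def prepend {n : ℕ} (σ : Equiv.Perm (Fin n)) (v : Fin (n + 1)) : Equiv.Perm (Fin (n + 1)) :=
  ((finSuccEquiv' 0).trans (Equiv.optionCongr σ)).trans (finSuccEquiv' v).symm

theorem prepend_zero {n : ℕ} (σ : Equiv.Perm (Fin n)) (v : Fin (n + 1)) :
    prepend σ v 0 = v := by
  simp [prepend]

theorem prepend_succ {n : ℕ} (σ : Equiv.Perm (Fin n)) (v : Fin (n + 1)) (i : Fin n) :
    prepend σ v i.succ = v.succAbove (σ i) := by
  have : finSuccEquiv' (0 : Fin (n + 1)) i.succ = some i := by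
    rw [← Fin.succAbove_zero, finSuccEquiv'_succAbove]
  simp [prepend, this]

theorem coe_succAbove {n : ℕ} (v : Fin (n + 1)) (x : Fin n) :
    (v.succAbove x : ℕ) = bump v x := by
  unfold bump
  rw [Fin.succAbove]
  simp only [Fin.lt_def, Fin.val_castSucc]
  split_ifs <;> simp <;> omega

theorem prepend_bijective (n : ℕ) :
    Function.Bijective fun x : Equiv.Perm (Fin n) × Fin (n + 1) => prepend x.1 x.2 := by
  rw [Fintype.bijective_iff_injective_and_card]
  constructor
  · rintro ⟨σ, v⟩ ⟨τ, w⟩ h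
    have hv : v = w := by
      have := congrArg (fun π : Equiv.Perm (Fin (n + 1)) => π 0) h
      simpa [prepend_zero] using this
    subst hv
    congr 1
    ext i
    have := congrArg (fun π : Equiv.Perm (Fin (n + 1)) => π i.succ) h
    simp only [prepend_succ] at this
    rw [Fin.succAbove_right_injective this]
  · simp [Fintype.card_perm, Nat.factorial_succ, mul_comm]

/-- `v` is an active site of `σ`: prepending the value `v` creates neither `1234` nor `2341`. -/
def Active {n : ℕ} (σ : Equiv.Perm (Fin n)) (v : ℕ) : Prop :=
  (∀ i j m : Fin n, i < j → j < m → v ≤ σ i → σ i < σ j → ¬ σ j < σ m) ∧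
  (∀ i j m : Fin n, i < j → j < m → v ≤ σ i → σ i < σ j → ¬ (σ m : ℕ) < v)

/-- There is an ascending pair of entries that are at least `v`. -/
def HasAscent {n : ℕ} (σ : Equiv.Perm (Fin n)) (v : ℕ) : Prop :=
  ∃ i j : Fin n, i < j ∧ v ≤ σ i ∧ σ i < σ j

/-- Some entry to the right of the maximum is less than `w`. -/
def HasBelowAfterMax {n : ℕ} (σ : Equiv.Perm (Fin n)) (w : ℕ) : Prop :=
  ∃ i j : Fin n, i < j ∧ (∀ m, σ m ≤ σ i) ∧ (σ j : ℕ) < w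

/-- `σ` contains neither `1234` nor `2341`. -/
def Avoids {n : ℕ} (σ : Equiv.Perm (Fin n)) : Prop :=
  (∀ i j m l : Fin n, i < j → j < m → m < l → σ i < σ j → σ j < σ m → ¬ σ m < σ l) ∧
  (∀ i j m l : Fin n, i < j → j < m → m < l → σ i < σ j → σ j < σ m → ¬ σ l < σ i)

theorem contains_four_iff (τ : Equiv.Perm (Fin 4)) {n : ℕ} (σ : Equiv.Perm (Fin n)) :
    Contains ⟨4, τ⟩ ⟨n, σ⟩ ↔ ∃ i j m l : Fin n, i < j ∧ j < m ∧ m < l ∧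
      ∀ a b : Fin 4, τ a < τ b ↔ σ (![i, j, m, l] a) < σ (![i, j, m, l] b) := by
  constructor
  · rintro ⟨f, hf⟩
    refine ⟨f 0, f 1, f 2, f 3, by simp, by simp, by simp, fun a b => ?_⟩
    have : ∀ a, ![f 0, f 1, f 2, f 3] a = f a := by
      intro a; fin_cases a <;> rfl
    rw [this, this]
    exact hf a b
  · rintro ⟨i, j, m, l, h1, h2, h3, h⟩
    have hs : StrictMono ![i, j, m, l] := by
      rw [Fin.strictMono_iff_lt_succ]
      intro a; fin_cases a <;> simpa
    exact ⟨OrderEmbedding.ofStrictMono _ hs, h⟩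

theorem avoids_iff {n : ℕ} (σ : Equiv.Perm (Fin n)) :
    Avoids σ ↔ ∀ τ ∈ ({p1234, p2341} : Set SizedPerm), ¬ Contains τ ⟨n, σ⟩ := by
  have h1 : Contains p1234 ⟨n, σ⟩ ↔ ∃ i j m l : Fin n, i < j ∧ j < m ∧ m < l ∧
      σ i < σ j ∧ σ j < σ m ∧ σ m < σ l := by
    rw [p1234, contains_four_iff]
    refine exists₄_congr fun i j m l => and_congr_right fun _ => and_congr_right fun _ =>
      and_congr_right fun _ => ?_
    simp [Fin.forall_fin_succ]
    omega
  have h2 : Contains p2341 ⟨n, σ⟩ ↔ ∃ i j m l : Fin n, i < j ∧ j < m ∧ m < l ∧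
      σ i < σ j ∧ σ j < σ m ∧ σ l < σ i := by
    rw [p2341, contains_four_iff]
    refine exists₄_congr fun i j m l => and_congr_right fun _ => and_congr_right fun _ =>
      and_congr_right fun _ => ?_
    simp [Fin.forall_fin_succ]
    omega
  simp only [Set.mem_insert_iff, Set.mem_singleton_iff, forall_eq_or_imp, forall_eq, h1, h2]
  simp only [Avoids]
  push Not
  rfl

theorem bump_lt_bump {v x y : ℕ} : bump v x < bump v y ↔ x < y := by
  unfold bump; split_ifs <;> omega

theorem lt_bump {v x : ℕ} : v < bump v x ↔ v ≤ x := by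
  unfold bump; split_ifs <;> omega

theorem bump_lt {v x : ℕ} : bump v x < v ↔ x < v := by
  unfold bump; split_ifs <;> omega

/-- A new occurrence of a pattern must use the new entry, which is leftmost and so plays the `1` of
`1234` or the `2` of `2341`. -/
theorem avoids_prepend {n : ℕ} (σ : Equiv.Perm (Fin n)) (v : Fin (n + 1)) :
    Avoids (prepend σ v) ↔ Avoids σ ∧ Active σ v := by
  simp only [Avoids, Active, Fin.forall_fin_succ, prepend_zero, prepend_succ,
    Fin.lt_def, coe_succAbove, bump_lt_bump, lt_bump, bump_lt, Fin.val_zero,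
    Fin.val_succ]
  simp
  tauto

open Classical in
/-- The number of permutations obtained from `σ` by prepending `d` entries at active sites. -/
noncomputable def extensions : ℕ → {n : ℕ} → Equiv.Perm (Fin n) → ℕ
  | 0, _, _ => 1
  | d + 1, n, σ => ∑ v : Fin (n + 1), if Active σ v then extensions d (prepend σ v) else 0

-- Every avoiding permutation of length `n + 1` arises once, from an avoiding `σ` and an active site
-- of `σ`.
open Classical in
theorem sum_extensions (d n : ℕ) :
    ∑ σ : Equiv.Perm (Fin n), (if Avoids σ then extensions (d + 1) σ else 0) =
      ∑ τ : Equiv.Perm (Fin (n + 1)), if Avoids τ then extensions d τ else 0 := by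
  rw [← (prepend_bijective n).sum_comp fun τ => if Avoids τ then extensions d τ else 0,
    Fintype.sum_prod_type]
  refine Finset.sum_congr rfl fun σ _ => ?_
  simp only [avoids_prepend, extensions]
  by_cases h : Avoids σ <;> simp [h]

open Classical in
theorem sum_extensions_zero (d n : ℕ) :
    ∑ σ : Equiv.Perm (Fin n), (if Avoids σ then extensions d σ else 0) =
      ∑ τ : Equiv.Perm (Fin (n + d)), if Avoids τ then 1 else 0 := by
  induction d generalizing n with
  | zero => simp [extensions]
  | succ d ih => rw [sum_extensions, ih, show n + 1 + d = n + (d + 1) by ring]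

theorem count_eq_extensions (N : ℕ) :
    count (Av {p1234, p2341}) (N + 1) = extensions (N + 1) (1 : Equiv.Perm (Fin 0)) := by
  classical
  have h := sum_extensions_zero (N + 1) 0
  rw [Fintype.sum_subsingleton _ 1, if_pos (by simp [Avoids])] at h
  rw [h, Finset.sum_boole, count, Nat.cast_id, Set.ncard_eq_toFinset_card', zero_add]
  congr 1
  ext σ
  simp [Av, avoids_iff]

theorem count_zero (B : Set SizedPerm) : count (Av B) 0 = 0 := by
  simp [count, Av]

/-! ### How prepending changes `k`, `a` and the active sites. -/

section

/-- The numerical data of `σ` which determine how it can be extended: `k` is the length of the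
longest decreasing sequence of largest values, `a` is the least entry to the right of the maximum,
`A` is the set of active sites. -/
structure Tracks {n : ℕ} (σ : Equiv.Perm (Fin n)) (k a : ℕ) (A : Finset ℕ) : Prop where
  le : k ≤ n
  hasAscent : ∀ v, HasAscent σ v ↔ v + k < n
  below : ∀ w ≤ n, HasBelowAfterMax σ w ↔ a < w
  mem : ∀ w, w ∈ A ↔ w ≤ n ∧ Active σ w

/-- The sites just above a new value `v` and higher. -/
def sitesAbove (A : Finset ℕ) (v : ℕ) : Finset ℕ := (A.filter (v ≤ ·)).image (· + 1)

theorem mem_sitesAbove {A : Finset ℕ} {v w : ℕ} : w ∈ sitesAbove A v ↔ v < w ∧ w - 1 ∈ A := by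
  simp only [sitesAbove, Finset.mem_image, Finset.mem_filter]
  constructor
  · rintro ⟨x, ⟨h1, h2⟩, rfl⟩
    exact ⟨by omega, h1⟩
  · rintro ⟨h1, h2⟩
    exact ⟨w - 1, ⟨h2, by omega⟩, by omega⟩

theorem bump_lt_of_lt {v x w : ℕ} (h : v < w) : bump v x < w ↔ x < w - 1 := by
  unfold bump; split_ifs <;> omega

theorem bump_lt_of_le {v x w : ℕ} (h : w ≤ v) : bump v x < w ↔ x < w := by
  unfold bump; split_ifs <;> omega

theorem le_bump_of_lt {v x w : ℕ} (h : v < w) : w ≤ bump v x ↔ w - 1 ≤ x := by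
  unfold bump; split_ifs <;> omega

theorem le_bump_of_le {v x w : ℕ} (h : w ≤ v) : w ≤ bump v x ↔ w ≤ x := by
  unfold bump; split_ifs <;> omega

variable {n : ℕ} (σ : Equiv.Perm (Fin n)) (v : Fin (n + 1))

/-- The entry `v < w` in front is too small to follow `w` in an ascent, and in `2341` only the last
letter is below the first, so it takes part in nothing. -/
theorem active_prepend_of_lt {w : ℕ} (h : (v : ℕ) < w) :
    Active (prepend σ v) w ↔ Active σ (w - 1) := by
  simp only [Active, Fin.forall_fin_succ, prepend_zero, prepend_succ,
    Fin.lt_def, coe_succAbove, bump_lt_bump, lt_bump, bump_lt, Fin.val_zero, Fin.val_succ,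
    le_bump_of_lt h, bump_lt_of_lt h]
  simp [h.not_ge]

/-- Besides the old occurrences, `w` and `v` can serve as the first two letters: an ascending pair
above `v` completes `1234`, an entry at least `v` followed by one below `w` completes `2341`. -/
theorem active_prepend_of_le {w : ℕ} (h : w ≤ v) :
    Active (prepend σ v) w ↔ Active σ w ∧ ¬ HasAscent σ v ∧
      ∀ i j : Fin n, i < j → (v : ℕ) ≤ σ i → w ≤ σ j := by
  simp only [Active, Fin.forall_fin_succ, prepend_zero, prepend_succ, HasAscent,
    Fin.lt_def, coe_succAbove, bump_lt_bump, lt_bump, bump_lt, Fin.val_zero, Fin.val_succ,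
    le_bump_of_le h, bump_lt_of_le h]
  simp [h]
  tauto

theorem hasAscent_prepend_of_lt {w : ℕ} (h : (v : ℕ) < w) :
    HasAscent (prepend σ v) w ↔ HasAscent σ (w - 1) := by
  simp only [HasAscent, Fin.exists_fin_succ, prepend_zero, prepend_succ,
    Fin.lt_def, coe_succAbove, bump_lt_bump, lt_bump, bump_lt, Fin.val_zero, Fin.val_succ,
    le_bump_of_lt h]
  simp [h.not_ge]

theorem hasAscent_prepend_of_le {w : ℕ} (h : w ≤ v) :
    HasAscent (prepend σ v) w ↔ HasAscent σ w ∨ (v : ℕ) < n := by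
  have : (∃ i, (v : ℕ) ≤ σ i) ↔ (v : ℕ) < n := by
    constructor
    · rintro ⟨i, hi⟩
      omega
    · intro hv
      exact ⟨σ.symm ⟨v, hv⟩, by simp⟩
  rw [← this]
  simp only [HasAscent, Fin.exists_fin_succ, prepend_zero, prepend_succ,
    Fin.lt_def, coe_succAbove, bump_lt_bump, lt_bump, bump_lt, Fin.val_zero, Fin.val_succ,
    le_bump_of_le h]
  simp [h, or_comm]

theorem hasBelowAfterMax_prepend_of_eq (h : (v : ℕ) = n) (w : ℕ) :
    HasBelowAfterMax (prepend σ v) w ↔ 0 < n ∧ 0 < w := by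
  constructor
  · rintro ⟨i, j, hij, -, hw⟩
    refine ⟨?_, by omega⟩
    have := i.2; have := j.2
    rw [Fin.lt_def] at hij
    omega
  · rintro ⟨hn, hw⟩
    refine ⟨0, (σ.symm ⟨0, hn⟩).succ, by simp, fun m => ?_, ?_⟩
    · rw [prepend_zero, Fin.le_def]
      omega
    · rw [prepend_succ, coe_succAbove]
      simp [bump, show ¬ (v : ℕ) ≤ 0 by omega, hw]

/-- The maximum stays an old entry and the new one stands to its left, so only the values shift. -/
theorem hasBelowAfterMax_prepend_of_lt (h : (v : ℕ) < n) (w : ℕ) :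
    HasBelowAfterMax (prepend σ v) w ↔ HasBelowAfterMax σ (if (v : ℕ) < w then w - 1 else w) := by
  have key : ∀ i, (∀ m, σ m ≤ σ i) → (v : ℕ) ≤ σ i := fun i hi => by
    simpa [Fin.le_def] using hi (σ.symm ⟨v, h⟩)
  have hb : ∀ x, bump v x < w ↔ x < if (v : ℕ) < w then w - 1 else w := fun x => by
    split_ifs with hv
    · exact bump_lt_of_lt hv
    · exact bump_lt_of_le (by omega)
  have hle : ∀ x y, bump v x ≤ bump v y ↔ x ≤ y := fun x y => by
    rw [← not_lt, bump_lt_bump, not_lt]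
  have hm : ∀ j, ¬ bump v (σ j) ≤ (v : ℕ) ↔ (v : ℕ) ≤ σ j := fun j => by
    rw [not_le, lt_bump]
  simp only [HasBelowAfterMax, Fin.exists_fin_succ, Fin.forall_fin_succ, prepend_zero,
    prepend_succ, Fin.lt_def, Fin.le_def, coe_succAbove, hle, Fin.val_zero, Fin.val_succ, hb]
  constructor
  · rintro (h' | ⟨i, h' | ⟨j, hij, ⟨-, hi⟩, hj⟩⟩)
    · rcases h' with h' | ⟨j, -, ⟨-, h'⟩, -⟩
      · omega
      · exact absurd (h' (σ.symm ⟨v, h⟩)) (by rw [hm]; simp)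
    · omega
    · exact ⟨i, j, by omega, hi, hj⟩
  · rintro ⟨i, j, hij, hi, hj⟩
    exact Or.inr ⟨i, Or.inr ⟨j, by omega, ⟨(lt_bump.2 (key i hi)).le, hi⟩, hj⟩⟩

variable {σ v}

/-- Without ascents above `v`, the maximum is the leftmost entry that is at least `v`, so whatever
follows some such entry follows the maximum. -/
theorem forall_after_iff {w : ℕ} (hv : (v : ℕ) < n) (h : ¬ HasAscent σ v) :
    (∀ i j : Fin n, i < j → (v : ℕ) ≤ σ i → w ≤ σ j) ↔ ¬ HasBelowAfterMax σ w := by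
  constructor
  · rintro h1 ⟨i, j, hij, hi, hj⟩
    have : (v : ℕ) ≤ σ i := by simpa [Fin.le_def] using hi (σ.symm ⟨v, hv⟩)
    have := h1 i j hij this
    omega
  · intro h1 i j hij hi
    by_contra! hj
    have : 0 < n := by omega
    set t := σ.symm ⟨n - 1, by omega⟩ with ht
    have hmax : ∀ m, σ m ≤ σ t := fun m => by
      simp only [ht, Equiv.apply_symm_apply, Fin.le_def]
      omega
    rcases lt_or_ge i t with hit | hit
    · exact h ⟨i, t, hit, hi, lt_of_le_of_ne (hmax i) fun h => hit.ne (σ.injective h)⟩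
    · exact h1 ⟨t, j, lt_of_le_of_lt hit hij, hmax, hj⟩

variable {k a : ℕ} {A : Finset ℕ}

theorem Tracks.prepend_max (h : Tracks σ k a A) (hv : (v : ℕ) = n) :
    Tracks (prepend σ v) (k + 1) (if n = 0 then 1 else 0) (insert (n + 1) A) where
  le := by have := h.le; omega
  hasAscent w := by
    rcases le_or_gt w v with hw | hw
    · rw [hasAscent_prepend_of_le _ _ hw, h.hasAscent]
      omega
    · rw [hasAscent_prepend_of_lt _ _ hw, h.hasAscent]
      have := h.le
      omega
  -- If `n = 0`, nothing follows the new maximum, and `a` must be at least the new length `1`;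
  -- otherwise the entry `0` follows it.
  below w hw := by
    rw [hasBelowAfterMax_prepend_of_eq _ _ hv]
    split_ifs <;> omega
  mem w := by
    have hasc : ¬ HasAscent σ v := by rw [h.hasAscent]; omega
    rw [Finset.mem_insert, h.mem]
    rcases le_or_gt w v with hw | hw
    · rw [active_prepend_of_le _ _ hw]
      have : ∀ i j : Fin n, i < j → (v : ℕ) ≤ σ i → w ≤ σ j := fun i j _ hi => by omega
      constructor
      · rintro (h | h)
        · omega
        · exact ⟨by omega, h.2, hasc, this⟩
      · exact fun h => Or.inr ⟨by omega, h.2.1⟩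
    · rw [active_prepend_of_lt _ _ hw]
      constructor
      · rintro (rfl | h)
        · refine ⟨le_rfl, ?_, ?_⟩ <;> intro i <;> intros <;> omega
        · omega
      · exact fun h => Or.inl (by omega)

/-- The `n - v` values above the new entry are decreasing, and the new entry precedes and ascends to
them, so the run stops there. Old sites `w ≤ v` survive exactly when no entry after the maximum is
below `w`. -/
theorem Tracks.prepend_top (h : Tracks σ k a A) (hv : (v : ℕ) < n) (hk : n ≤ v + k) :
    Tracks (prepend σ v) (n - v) (bump v a)
      (sitesAbove A v ∪ A.filter fun w => w ≤ v ∧ w ≤ a) where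
  le := by omega
  hasAscent w := by
    rcases le_or_gt w v with hw | hw
    · rw [hasAscent_prepend_of_le _ _ hw, h.hasAscent]
      omega
    · rw [hasAscent_prepend_of_lt _ _ hw, h.hasAscent]
      omega
  below w hw := by
    rw [hasBelowAfterMax_prepend_of_lt _ _ hv, h.below _ (by split_ifs <;> omega)]
    unfold bump
    split_ifs <;> omega
  mem w := by
    have hasc : ¬ HasAscent σ v := by rw [h.hasAscent]; omega
    rw [Finset.mem_union, mem_sitesAbove, Finset.mem_filter, h.mem, h.mem]
    rcases le_or_gt w v with hw | hw
    · rw [active_prepend_of_le _ _ hw, forall_after_iff hv hasc, h.below w (by omega)]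
      simp only [hasc, not_false_eq_true, true_and, hw, hw.not_gt, false_and, false_or, not_lt]
      have : w ≤ n := by omega
      have : w ≤ n + 1 := by omega
      tauto
    · rw [active_prepend_of_lt _ _ hw]
      simp only [hw, hw.not_ge, false_and, and_false, or_false, true_and]
      exact and_congr_left fun _ => by omega

/-- An ascending pair above `v` makes every site `w ≤ v` inactive, as `w`, `v` and the pair form
`1234`. The top `k` values are untouched. -/
theorem Tracks.prepend_low (h : Tracks σ k a A) (hk : v + k < n) :
    Tracks (prepend σ v) k (bump v a) (sitesAbove A v) where
  le := by omega
  hasAscent w := by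
    rcases le_or_gt w v with hw | hw
    · rw [hasAscent_prepend_of_le _ _ hw, h.hasAscent]
      omega
    · rw [hasAscent_prepend_of_lt _ _ hw, h.hasAscent]
      omega
  below w hw := by
    rw [hasBelowAfterMax_prepend_of_lt _ _ (by omega), h.below _ (by split_ifs <;> omega)]
    unfold bump
    split_ifs <;> omega
  mem w := by
    have hasc : HasAscent σ v := by rwa [h.hasAscent]
    rw [mem_sitesAbove, h.mem]
    rcases le_or_gt w v with hw | hw
    · rw [active_prepend_of_le _ _ hw]
      simp [hasc, hw.not_gt]
    · rw [active_prepend_of_lt _ _ hw]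
      simp only [hw, true_and]
      exact and_congr_left fun _ => by omega

/-- The number of permutations obtained by prepending `d` entries at active sites to a permutation
of length `n` with data `k`, `a`, `A`. -/
def siteCount : ℕ → ℕ → ℕ → ℕ → Finset ℕ → ℕ
  | 0, _, _, _, _ => 1
  | d + 1, n, k, a, A => ∑ v ∈ A,
      if v = n then siteCount d (n + 1) (k + 1) (if n = 0 then 1 else 0) (insert (n + 1) A)
      else if n ≤ v + k then siteCount d (n + 1) (n - v) (bump v a)
        (sitesAbove A v ∪ A.filter fun w => w ≤ v ∧ w ≤ a)
      else siteCount d (n + 1) k (bump v a) (sitesAbove A v)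

theorem Tracks.extensions_eq (d : ℕ) {n : ℕ} {σ : Equiv.Perm (Fin n)} {k a : ℕ} {A : Finset ℕ}
    (h : Tracks σ k a A) : extensions d σ = siteCount d n k a A := by
  induction d generalizing n k a A with
  | zero => simp [extensions, siteCount]
  | succ d ih =>
    classical
    have hA : A = (Finset.range (n + 1)).filter (Active σ) := by
      ext w
      rw [h.mem]
      simp
    rw [extensions, siteCount]
    nth_rw 1 [hA]
    rw [Finset.sum_filter, Finset.sum_range]
    refine Finset.sum_congr rfl fun v _ => ?_
    by_cases h1 : Active σ v
    · rw [if_pos h1, if_pos h1]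
      by_cases h2 : (v : ℕ) = n
      · rw [if_pos h2, ih (h.prepend_max h2)]
      · rw [if_neg h2]
        by_cases h3 : n ≤ v + k
        · rw [if_pos h3, ih (h.prepend_top (by omega) h3)]
        · rw [if_neg h3, ih (h.prepend_low (by omega))]
    · rw [if_neg h1, if_neg h1]

theorem tracks_empty : Tracks (1 : Equiv.Perm (Fin 0)) 0 0 {0} where
  le := le_rfl
  hasAscent v := by simp [HasAscent]
  below w hw := by simp [HasBelowAfterMax]; omega
  mem w := by simp [Active]

theorem count_eq_siteCount (N : ℕ) :
    count (Av {p1234, p2341}) (N + 1) = siteCount (N + 1) 0 0 0 {0} := by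
  rw [count_eq_extensions, tracks_empty.extensions_eq]

end

/-! ### The generating tree. -/

section

/-- The labels of the generating tree. -/
inductive Label where
  | dec (n : ℕ)
  | mid (f : Bool) (m l : ℕ)
  | gen (f : Bool) (m p q : ℕ)

/-- The number of nodes at depth `d` below a node with a given label. -/
def labelCount : ℕ → Label → ℕ
  | 0, _ => 1
  | d + 1, .dec 0 => labelCount d (.dec 1)
  | d + 1, .dec (m + 1) => labelCount d (.dec (m + 2)) + labelCount d (.mid true m 0) +
      ∑ i ∈ Finset.range m, labelCount d (.gen true i 0 0)
  | d + 1, .mid f m l => labelCount d (.gen f (m + 1) 0 l) +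
      (labelCount d (.mid f m (l + 1)) +
        ∑ i ∈ Finset.range m, labelCount d (.gen f i (l + 1) 0)) +
      ∑ x ∈ Finset.range (l + f.toNat), labelCount d (.mid false m (x + 1))
  | d + 1, .gen f m p q => labelCount d (.gen f (m + 1) 0 (p + q)) +
      ∑ i ∈ Finset.range (m + 1), labelCount d (.gen f i p 0) +
      (∑ x ∈ Finset.range (p + f.toNat), labelCount d (.gen false m (x + 1) q) +
      ∑ x ∈ Finset.range q, labelCount d (.gen false m 0 (x + 1)))

/-- The sites with an ascending pair of entries above them. -/
def lowSites (n k : ℕ) (A : Finset ℕ) : Finset ℕ := A.filter fun w => w + k < n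

/-- The label of a permutation with the given data. -/
def HasLabel (n k a : ℕ) (A : Finset ℕ) : Label → Prop
  | .dec j => j = n ∧ k = n ∧ (2 ≤ n → a = 0)
  | .mid f m l => k = m + 1 ∧ k < n ∧ n ≤ a + k ∧ (1 ≤ m → a + k = n) ∧ (0 ∈ A ↔ f = true) ∧
      (lowSites n k A).card = l + f.toNat
  | .gen f m p q => k = m + 1 ∧ a + k < n ∧ (0 ∈ A ↔ f = true) ∧
      (A.filter (· ≤ a)).card = p + f.toNat ∧ ((lowSites n k A).filter (a < ·)).card = q

/-- The sites with at most `k` entries above them are all active. -/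
structure TopActive (n k : ℕ) (A : Finset ℕ) : Prop where
  le_length : k ≤ n
  le : ∀ w ∈ A, w ≤ n
  mem : ∀ w ≤ n, n ≤ w + k → w ∈ A

/-- As `v` runs through `S`, the number of elements of `S` that are at least `v` takes each value
from `1` to `S.card` once. This turns sums over sites into sums over labels. -/
theorem sum_card_filter_le (S : Finset ℕ) (F : ℕ → ℕ) :
    ∑ v ∈ S, F (S.filter (v ≤ ·)).card = ∑ x ∈ Finset.range S.card, F (x + 1) := by
  induction S using Finset.induction_on_min with
  | empty => simp
  | insert a s ha ih =>
    have hs : a ∉ s := fun h => (ha a h).false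
    rw [Finset.sum_insert hs, Finset.card_insert_of_notMem hs, Finset.sum_range_succ, add_comm, ← ih]
    congr 1
    · refine Finset.sum_congr rfl fun v hv => ?_
      rw [Finset.filter_insert, if_neg (ha v hv).not_ge]
    · rw [Finset.filter_true_of_mem, Finset.card_insert_of_notMem hs]
      intro x hx
      rcases Finset.mem_insert.1 hx with rfl | hx
      · exact le_rfl
      · exact (ha x hx).le

theorem sum_sites {n k : ℕ} {A : Finset ℕ} (h : TopActive n k A) (F : ℕ → ℕ) :
    ∑ v ∈ A, F v =
      F n + ∑ i ∈ Finset.range k, F (n - 1 - i) + ∑ v ∈ lowSites n k A, F v := by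
  rw [← Finset.sum_filter_add_sum_filter_not A (fun w => w + k < n), add_comm]
  congr 1
  have : A.filter (fun w => ¬ w + k < n) =
      insert n ((Finset.range k).image fun i => n - 1 - i) := by
    ext w
    simp only [Finset.mem_filter, Finset.mem_insert, Finset.mem_image, Finset.mem_range]
    have := h.le_length
    constructor
    · rintro ⟨h1, h2⟩
      have := h.le w h1
      by_cases hw : w = n
      · exact Or.inl hw
      · exact Or.inr ⟨n - 1 - w, by omega, by omega⟩
    · rintro (rfl | ⟨i, hi, rfl⟩)
      · exact ⟨h.mem _ le_rfl (by omega), by omega⟩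
      · exact ⟨h.mem _ (by omega) (by omega), by omega⟩
  rw [this, Finset.sum_insert, Finset.sum_image]
  · intro i hi j hj hij
    have := h.le_length
    simp only [Finset.coe_range, Set.mem_Iio] at hi hj hij
    omega
  · simp only [Finset.mem_image, Finset.mem_range, not_exists, not_and]
    have := h.le_length
    intro i hi
    omega

theorem card_filter_sitesAbove (A : Finset ℕ) (v : ℕ) (P : ℕ → Prop) [DecidablePred P] :
    ((sitesAbove A v).filter P).card = (A.filter fun w => v ≤ w ∧ P (w + 1)).card := by
  rw [sitesAbove, Finset.filter_image, Finset.card_image_of_injective _ (add_left_injective 1),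
    Finset.filter_filter]

theorem card_lowSites_sitesAbove (A : Finset ℕ) (n k v : ℕ) :
    (lowSites (n + 1) k (sitesAbove A v)).card = ((lowSites n k A).filter (v ≤ ·)).card := by
  rw [lowSites, lowSites, card_filter_sitesAbove, Finset.filter_filter]
  congr 1
  exact Finset.filter_congr fun w _ => by omega

theorem zero_notMem_sitesAbove (A : Finset ℕ) (v : ℕ) : 0 ∉ sitesAbove A v := by
  simp [mem_sitesAbove]

namespace TopActive

variable {n k v a : ℕ} {A : Finset ℕ} (h : TopActive n k A)
include h

theorem prepend_max : TopActive (n + 1) (k + 1) (insert (n + 1) A) where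
  le_length := by have := h.le_length; omega
  le w hw := by
    rcases Finset.mem_insert.1 hw with rfl | hw
    · exact le_rfl
    · have := h.le w hw; omega
  mem w h1 h2 := by
    rw [Finset.mem_insert]
    by_cases hw : w = n + 1
    · exact Or.inl hw
    · exact Or.inr (h.mem w (by omega) (by omega))

theorem prepend_top (hv : v < n) (hk : n ≤ v + k) :
    TopActive (n + 1) (n - v) (sitesAbove A v ∪ A.filter fun w => w ≤ v ∧ w ≤ a) where
  le_length := by omega
  le w hw := by
    rw [Finset.mem_union, mem_sitesAbove, Finset.mem_filter] at hw
    rcases hw with hw | hw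
    · have := h.le _ hw.2; omega
    · omega
  mem w h1 h2 := by
    rw [Finset.mem_union, mem_sitesAbove]
    exact Or.inl ⟨by omega, h.mem _ (by omega) (by omega)⟩

theorem prepend_low (hk : v + k < n) : TopActive (n + 1) k (sitesAbove A v) where
  le_length := by omega
  le w hw := by
    rw [mem_sitesAbove] at hw
    have := h.le _ hw.2; omega
  mem w h1 h2 := by
    rw [mem_sitesAbove]
    exact ⟨by omega, h.mem _ (by omega) (by omega)⟩

end TopActive

variable {n k a : ℕ} {A : Finset ℕ}

theorem siteCount_succ (h : TopActive n k A) (d : ℕ) :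
    siteCount (d + 1) n k a A =
      siteCount d (n + 1) (k + 1) (if n = 0 then 1 else 0) (insert (n + 1) A) +
      ∑ i ∈ Finset.range k, siteCount d (n + 1) (i + 1) (bump (n - 1 - i) a)
        (sitesAbove A (n - 1 - i) ∪ A.filter fun w => w ≤ n - 1 - i ∧ w ≤ a) +
      ∑ v ∈ lowSites n k A, siteCount d (n + 1) k (bump v a) (sitesAbove A v) := by
  have := h.le_length
  rw [siteCount, sum_sites h, if_pos rfl]
  congr 1
  · congr 1
    refine Finset.sum_congr rfl fun i hi => ?_
    rw [Finset.mem_range] at hi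
    rw [if_neg (by omega), if_pos (by omega), show n - (n - 1 - i) = i + 1 by omega]
  · refine Finset.sum_congr rfl fun v hv => ?_
    rw [lowSites, Finset.mem_filter] at hv
    rw [if_neg (by omega), if_neg (by omega)]

/-- With a nonempty old permutation to the right of the new maximum, `a = 0`: the only possible site
up to `a` is `0`, and all other low sites count towards `q`. -/
theorem HasLabel.gen_max {f : Bool} (hn : k < n) (h0 : 0 ∈ A ↔ f = true) {q : ℕ}
    (h : (lowSites n k A).card = q + f.toNat) :
    HasLabel (n + 1) (k + 1) 0 (insert (n + 1) A) (.gen f k 0 q) := by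
  refine ⟨rfl, by omega, by simp [h0], ?_, ?_⟩
  · have : (insert (n + 1) A).filter (· ≤ 0) = if f = true then {0} else ∅ := by
      ext w
      split_ifs with hf
      · simp only [Finset.mem_filter, Finset.mem_insert, Finset.mem_singleton]
        constructor
        · omega
        · rintro rfl
          exact ⟨Or.inr (h0.2 hf), le_rfl⟩
      · simp only [Finset.mem_filter, Finset.mem_insert, Finset.notMem_empty, iff_false]
        rintro ⟨hw | hw, hw'⟩
        · omega
        · rw [Nat.le_zero.1 hw'] at hw
          exact hf (h0.1 hw)
    rw [this]
    cases f <;> simp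
  · have : (lowSites (n + 1) (k + 1) (insert (n + 1) A)).filter (0 < ·) =
        (lowSites n k A).erase 0 := by
      ext w
      simp only [lowSites, Finset.mem_filter, Finset.mem_insert, Finset.mem_erase]
      constructor
      · rintro ⟨⟨hw | hw, h1⟩, h2⟩
        · omega
        · exact ⟨by omega, hw, by omega⟩
      · rintro ⟨h1, h2, h3⟩
        exact ⟨⟨Or.inr h2, by omega⟩, by omega⟩
    rw [this]
    cases f
    · rw [Finset.erase_eq_of_notMem, h, Bool.toNat_false, add_zero]
      intro hw
      have := h0.1 (Finset.mem_filter.1 hw).1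
      simp at this
    · rw [Finset.card_erase_of_mem, h]
      · simp
      · rw [lowSites, Finset.mem_filter]
        exact ⟨h0.2 rfl, by omega⟩

/-- Since `a < v`, the sites in `(a, v]` are lost, and those above `v` are not low. So the sites up
to `a` persist and `q` becomes `0`. -/
theorem HasLabel.gen_top {f : Bool} {i p : ℕ} (hi : i < n) (ha : a < n - 1 - i)
    (h0 : 0 ∈ A ↔ f = true) (h : (A.filter (· ≤ a)).card = p + f.toNat) :
    HasLabel (n + 1) (i + 1) (bump (n - 1 - i) a)
      (sitesAbove A (n - 1 - i) ∪ A.filter fun w => w ≤ n - 1 - i ∧ w ≤ a) (.gen f i p 0) := by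
  have hb : bump (n - 1 - i) a = a := by rw [bump, if_neg (by omega)]
  rw [hb]
  refine ⟨rfl, by omega, by simp [zero_notMem_sitesAbove, h0], ?_, ?_⟩
  · rw [← h]
    congr 1
    ext w
    simp only [Finset.mem_filter, Finset.mem_union, mem_sitesAbove]
    constructor
    · rintro ⟨hw | hw, h1⟩
      · omega
      · exact ⟨hw.1, h1⟩
    · rintro ⟨hw, h1⟩
      exact ⟨Or.inr ⟨hw, by omega, h1⟩, h1⟩
  · rw [Finset.card_eq_zero, Finset.filter_eq_empty_iff]
    intro w hw
    simp only [lowSites, Finset.mem_filter, Finset.mem_union, mem_sitesAbove] at hw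
    omega

/-- In `mid` the equation `a + k = n` is required only for `m ≥ 1`: when `k = 1`, nothing may follow
the maximum, and then `a` has a default value that is at least `n`. -/
theorem siteCount_eq_labelCount (d : ℕ) {n k a : ℕ} {A : Finset ℕ} (h : TopActive n k A)
    {L : Label} (hL : HasLabel n k a A L) : siteCount d n k a A = labelCount d L := by
  induction d generalizing n k a A L with
  | zero => simp [siteCount, labelCount]
  | succ d ih =>
    rw [siteCount_succ h]
    have htop : ∀ i ∈ Finset.range k, TopActive (n + 1) (i + 1)
        (sitesAbove A (n - 1 - i) ∪ A.filter fun w => w ≤ n - 1 - i ∧ w ≤ a) := fun i hi => by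
      have := h.le_length
      rw [Finset.mem_range] at hi
      have := h.prepend_top (v := n - 1 - i) (a := a) (by omega) (by omega)
      rwa [show n - (n - 1 - i) = i + 1 by omega] at this
    have hlow : ∀ v ∈ lowSites n k A, TopActive (n + 1) k (sitesAbove A v) := fun v hv => by
      rw [lowSites, Finset.mem_filter] at hv
      exact h.prepend_low hv.2
    cases L with
    | dec j =>
      obtain ⟨rfl, rfl, ha⟩ := hL
      have hA : A = Finset.range (k + 1) := by
        ext w
        rw [Finset.mem_range]
        exact ⟨fun hw => by have := h.le w hw; omega, fun hw => h.mem w (by omega) (by omega)⟩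
      have hl : lowSites k k A = ∅ := by
        rw [lowSites, Finset.filter_eq_empty_iff]
        intro w _
        omega
      rw [hl, Finset.sum_empty, add_zero]
      have hmax := ih h.prepend_max (a := if k = 0 then 1 else 0) (L := .dec (k + 1))
        ⟨rfl, rfl, fun _ => if_neg (by omega)⟩
      rw [hmax]
      cases k with
      | zero => simp [labelCount]
      | succ m =>
        -- The lowest top site, `i = m`, is split off: it alone gives a child of type `mid`, the
        -- higher ones giving `gen`.
        rw [labelCount, Finset.sum_range_succ, add_comm (∑ i ∈ Finset.range m, _),
          ← add_assoc (labelCount d _)]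
        congr 1
        congr 1
        · refine ih (htop m (by simp)) ⟨rfl, by omega, ?_, fun hm => ?_, ?_, ?_⟩
          · simp [bump]
          · simp [bump, ha (by omega)]
            omega
          · simp [zero_notMem_sitesAbove, hA]
          · have : lowSites (m + 1 + 1) (m + 1) (sitesAbove A (m + 1 - 1 - m) ∪
                A.filter fun w => w ≤ m + 1 - 1 - m ∧ w ≤ a) = {0} := by
              ext w
              simp only [lowSites, Finset.mem_filter, Finset.mem_union, mem_sitesAbove, hA,
                Finset.mem_range, Finset.mem_singleton]
              omega
            rw [this]
            simp
        · refine Finset.sum_congr rfl fun i hi => ?_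
          rw [Finset.mem_range] at hi
          refine ih (htop i (by simp; omega)) (HasLabel.gen_top (by omega) ?_ (by simp [hA]) ?_)
          · rw [ha (by omega)]
            omega
          · have : A.filter (· ≤ a) = {0} := by
              ext w
              simp only [Finset.mem_filter, hA, ha (by omega), Finset.mem_range,
                Finset.mem_singleton]
              omega
            rw [this]
            simp
    | mid f m l =>
      obtain ⟨rfl, hn, hna, ha, h0, hc⟩ := hL
      rw [labelCount, if_neg (by omega), ih h.prepend_max (HasLabel.gen_max hn h0 hc),
        Finset.sum_range_succ, add_comm (∑ i ∈ Finset.range m, _)]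
      congr 1
      · congr 1
        congr 1
        · refine ih (htop m (by simp)) ⟨rfl, by omega, ?_, fun hm => ?_, ?_, ?_⟩
          · unfold bump
            split_ifs <;> omega
          · have := ha hm
            unfold bump
            split_ifs <;> omega
          · simp [zero_notMem_sitesAbove, h0]
          · have : lowSites (n + 1) (m + 1) (sitesAbove A (n - 1 - m) ∪
                A.filter fun w => w ≤ n - 1 - m ∧ w ≤ a) =
                insert (n - 1 - m) (lowSites n (m + 1) A) := by
              ext w
              simp only [lowSites, Finset.mem_filter, Finset.mem_union, mem_sitesAbove,
                Finset.mem_insert]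
              constructor
              · rintro ⟨hw | hw, h1⟩
                · omega
                · by_cases hw' : w = n - 1 - m
                  · exact Or.inl hw'
                  · exact Or.inr ⟨hw.1, by omega⟩
              · rintro (rfl | ⟨hw, h1⟩)
                · exact ⟨Or.inr ⟨h.mem _ (by omega) (by omega), by omega⟩, by omega⟩
                · exact ⟨Or.inr ⟨hw, by omega⟩, by omega⟩
            rw [this, Finset.card_insert_of_notMem, hc]
            · omega
            · rw [lowSites, Finset.mem_filter]
              omega
        · refine Finset.sum_congr rfl fun i hi => ?_
          rw [Finset.mem_range] at hi
          have hm := ha (by omega)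
          refine ih (htop i (by simp; omega)) (HasLabel.gen_top (by omega) (by omega) h0 ?_)
          -- Here `a = n - k` is itself the lowest top site, which accounts for the `l + 1` in the
          -- label of the child.
          have : A.filter (· ≤ a) = insert a (lowSites n (m + 1) A) := by
            ext w
            simp only [lowSites, Finset.mem_filter, Finset.mem_insert]
            constructor
            · rintro ⟨hw, h1⟩
              by_cases hw' : w = a
              · exact Or.inl hw'
              · exact Or.inr ⟨hw, by omega⟩
            · rintro (rfl | ⟨hw, h1⟩)
              · exact ⟨h.mem _ (by omega) (by omega), le_rfl⟩
              · exact ⟨hw, by omega⟩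
          rw [this, Finset.card_insert_of_notMem, hc]
          · omega
          · rw [lowSites, Finset.mem_filter]
            omega
      · rw [← hc, ← sum_card_filter_le _ fun x => labelCount d (.mid false m x)]
        refine Finset.sum_congr rfl fun v hv => ?_
        refine ih (hlow v hv) ⟨rfl, by omega, ?_, fun hm => ?_, ?_, ?_⟩
        · rw [lowSites, Finset.mem_filter] at hv
          unfold bump
          split_ifs <;> omega
        · have := ha hm
          rw [lowSites, Finset.mem_filter] at hv
          unfold bump
          split_ifs <;> omega
        · simp [zero_notMem_sitesAbove]
        · rw [card_lowSites_sitesAbove]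
          simp
    | gen f m p q =>
      obtain ⟨rfl, hn, h0, hp, hq⟩ := hL
      have hlp : (lowSites n (m + 1) A).filter (fun w => ¬ a < w) = A.filter (· ≤ a) := by
        ext w
        simp only [lowSites, Finset.mem_filter]
        constructor
        · rintro ⟨⟨h1, h2⟩, h3⟩
          exact ⟨h1, by omega⟩
        · rintro ⟨h1, h2⟩
          exact ⟨⟨h1, by omega⟩, by omega⟩
      have hc : (lowSites n (m + 1) A).card = p + q + f.toNat := by
        rw [← Finset.card_filter_add_card_filter_not (a < ·), hlp, hp, hq]
        omega
      rw [labelCount, if_neg (by omega), ih h.prepend_max (HasLabel.gen_max (by omega) h0 hc)]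
      congr 1
      · congr 1
        refine Finset.sum_congr rfl fun i hi => ?_
        refine ih (htop i hi) (HasLabel.gen_top ?_ ?_ h0 hp) <;>
          rw [Finset.mem_range] at hi <;> omega
      -- A low site `v ≤ a` raises `a` and keeps all `q` sites beyond it; a site `v > a` leaves `a`
      -- fixed and wipes out all sites up to `a`.
      · rw [← Finset.sum_filter_add_sum_filter_not _ (a < ·), add_comm, hlp, ← hp, ← hq,
          ← sum_card_filter_le _ fun x => labelCount d (.gen false m 0 x),
          ← sum_card_filter_le _ fun x => labelCount d (.gen false m x _)]
        congr 1
        · refine Finset.sum_congr rfl fun v hv => ?_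
          have hv' : v ∈ lowSites n (m + 1) A := by
            rw [← hlp] at hv
            exact (Finset.mem_filter.1 hv).1
          rw [Finset.mem_filter] at hv
          have hb : bump v a = a + 1 := by simp [bump, hv.2]
          refine ih (hlow v hv') ⟨rfl, ?_, ?_, ?_, ?_⟩
          · omega
          · simp [zero_notMem_sitesAbove]
          · rw [hb, card_filter_sitesAbove, Finset.filter_filter]
            simp [and_comm]
          · rw [hb, lowSites, Finset.filter_filter, card_filter_sitesAbove, lowSites,
              Finset.filter_filter]
            congr 1
            exact Finset.filter_congr fun w _ => by omega
        · refine Finset.sum_congr rfl fun v hv => ?_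
          have hv' := (Finset.mem_filter.1 hv).1
          rw [Finset.mem_filter, lowSites, Finset.mem_filter] at hv
          have hb : bump v a = a := by simp [bump, hv.2]
          refine ih (hlow v hv') ⟨rfl, ?_, ?_, ?_, ?_⟩
          · omega
          · simp [zero_notMem_sitesAbove]
          · rw [hb, Bool.toNat_false, add_zero, Finset.card_eq_zero, Finset.filter_eq_empty_iff]
            intro w hw
            rw [mem_sitesAbove] at hw
            omega
          · rw [hb, lowSites, Finset.filter_filter, card_filter_sitesAbove, lowSites,
              Finset.filter_filter, Finset.filter_filter]
            congr 1
            exact Finset.filter_congr fun w _ => by omega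

theorem count_eq_labelCount (N : ℕ) :
    count (Av {p1234, p2341}) (N + 1) = labelCount (N + 1) (.dec 0) := by
  rw [count_eq_siteCount]
  refine siteCount_eq_labelCount _ ⟨le_rfl, by simp, by simp⟩ ⟨rfl, rfl, by simp⟩

end

/-! ### Sums over a parameter, weighted by powers of a series without constant term. -/

open PowerSeries in
theorem eq_zero_of_X_pow_dvd {x : ℚ⟦X⟧} (h : ∀ N, (X : ℚ⟦X⟧) ^ N ∣ x) : x = 0 := by
  ext n
  exact X_pow_dvd_iff.1 (h (n + 1)) n (Nat.lt_succ_self n)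

/-- The sum `∑ w ^ l * a l` for a power series `w` without constant term. -/
noncomputable def evalSeq (w : ℚ⟦X⟧) (a : ℕ → ℚ⟦X⟧) : ℚ⟦X⟧ :=
  PowerSeries.mk fun n => ∑ l ∈ Finset.range (n + 1), PowerSeries.coeff n (w ^ l * a l)

section evalSeq

open PowerSeries

variable {w : ℚ⟦X⟧}

/-- The term `w ^ l * a l` is divisible by `X ^ l`, so terms with `l > n` cannot reach the
coefficient of `X ^ n`. This justifies the truncation in `evalSeq`. -/
theorem X_pow_dvd_evalSeq_sub (hw : X ∣ w) (a : ℕ → ℚ⟦X⟧) (N : ℕ) :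
    X ^ N ∣ evalSeq w a - ∑ l ∈ Finset.range N, w ^ l * a l := by
  rw [X_pow_dvd_iff]
  intro m hm
  rw [map_sub, map_sum, evalSeq, coeff_mk, sub_eq_zero]
  refine Finset.sum_subset (Finset.range_subset_range.2 hm) fun l _ hl => ?_
  exact X_pow_dvd_iff.1 ((pow_dvd_pow_of_dvd hw l).mul_right _) m (by simpa using hl)

theorem evalSeq_unique (hw : X ∣ w) {a : ℕ → ℚ⟦X⟧} {x : ℚ⟦X⟧}
    (h : ∀ N, X ^ N ∣ x - ∑ l ∈ Finset.range N, w ^ l * a l) : x = evalSeq w a := by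
  rw [← sub_eq_zero]
  refine eq_zero_of_X_pow_dvd fun N => ?_
  have := dvd_sub (h N) (X_pow_dvd_evalSeq_sub hw a N)
  rwa [sub_sub_sub_cancel_right] at this

theorem evalSeq_add (w : ℚ⟦X⟧) (a b : ℕ → ℚ⟦X⟧) :
    evalSeq w (fun l => a l + b l) = evalSeq w a + evalSeq w b := by
  ext n
  simp [evalSeq, mul_add, Finset.sum_add_distrib]

theorem evalSeq_sub (w : ℚ⟦X⟧) (a b : ℕ → ℚ⟦X⟧) :
    evalSeq w (fun l => a l - b l) = evalSeq w a - evalSeq w b := by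
  ext n
  simp [evalSeq, mul_sub, Finset.sum_sub_distrib]

theorem evalSeq_mul (hw : X ∣ w) (c : ℚ⟦X⟧) (a : ℕ → ℚ⟦X⟧) :
    evalSeq w (fun l => c * a l) = c * evalSeq w a := by
  refine (evalSeq_unique hw fun N => ?_).symm
  have := (X_pow_dvd_evalSeq_sub hw a N).mul_left c
  rw [mul_sub, Finset.mul_sum] at this
  convert this using 3
  ring

theorem evalSeq_succ (hw : X ∣ w) (a : ℕ → ℚ⟦X⟧) :
    evalSeq w a = a 0 + w * evalSeq w fun l => a (l + 1) := by
  refine (evalSeq_unique hw fun N => ?_).symm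
  cases N with
  | zero => simp
  | succ N =>
    have := mul_dvd_mul hw (X_pow_dvd_evalSeq_sub hw (fun l => a (l + 1)) N)
    rw [mul_sub, Finset.mul_sum, mul_comm X, ← pow_succ] at this
    rw [Finset.sum_range_succ']
    have e : ∀ i, w ^ (i + 1) * a (i + 1) = w * (w ^ i * a (i + 1)) := fun i => by ring
    simp only [e, pow_zero, one_mul]
    convert this using 1
    ring

theorem evalSeq_sum (w : ℚ⟦X⟧) (s : Finset ℕ) (a : ℕ → ℕ → ℚ⟦X⟧) :
    evalSeq w (fun l => ∑ i ∈ s, a i l) = ∑ i ∈ s, evalSeq w (a i) := by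
  ext n
  simp only [evalSeq, coeff_mk, map_sum, Finset.mul_sum]
  rw [Finset.sum_comm]

theorem one_sub_mul_evalSeq_const (hw : X ∣ w) (c : ℚ⟦X⟧) :
    (1 - w) * evalSeq w (fun _ => c) = c := by
  linear_combination evalSeq_succ hw fun _ => c

theorem one_sub_mul_evalSeq_pow (hw : X ∣ w) (r : ℚ⟦X⟧) (k : ℕ) :
    (1 - w * r) * evalSeq w (fun l => r ^ (l + k)) = r ^ k := by
  have h := evalSeq_succ hw fun l => r ^ (l + k)
  have : (fun l => r ^ (l + 1 + k)) = fun l => r * r ^ (l + k) := by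
    funext l; ring
  rw [this, evalSeq_mul hw r fun l => r ^ (l + k), zero_add] at h
  linear_combination h

theorem one_sub_mul_evalSeq_sum_range (hw : X ∣ w) (a : ℕ → ℚ⟦X⟧) :
    (1 - w) * evalSeq w (fun l => ∑ i ∈ Finset.range l, a i) = w * evalSeq w a := by
  have h := evalSeq_succ hw fun l => ∑ i ∈ Finset.range l, a i
  simp only [Finset.sum_range_succ, evalSeq_add, Finset.range_zero, Finset.sum_empty] at h
  linear_combination h

theorem one_sub_mul_evalSeq_sum_range_succ (hw : X ∣ w) (a : ℕ → ℚ⟦X⟧) :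
    (1 - w) * evalSeq w (fun l => ∑ i ∈ Finset.range (l + 1), a i) = evalSeq w a := by
  simp only [Finset.sum_range_succ, evalSeq_add]
  linear_combination one_sub_mul_evalSeq_sum_range hw a

end evalSeq

/-! ### Recurrences for the subtree series, and the Catalan subtrees. -/

/-- The generating function of the subtree below a node with label `L`. -/
noncomputable def labelSeries (L : Label) : ℚ⟦X⟧ := PowerSeries.mk fun d => (labelCount d L : ℚ)

/-- The generating function of the Catalan numbers. -/
noncomputable def catalanQ : ℚ⟦X⟧ := PowerSeries.catalanSeries.map (Nat.castRingHom ℚ)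

section series

open PowerSeries

local notation "u" => fun m p q => labelSeries (Label.gen false m p q)
local notation "v" => fun m p q => labelSeries (Label.gen true m p q)
local notation "C" => catalanQ

theorem X_mul_catalanQ_sq : (X : ℚ⟦X⟧) * C ^ 2 = C - 1 := by
  have := congrArg (PowerSeries.map (Nat.castRingHom ℚ)) catalanSeries_sq_mul_X_add_one
  rw [map_add, map_mul, map_pow, map_one, map_X] at this
  rw [catalanQ]
  linear_combination this

theorem constantCoeff_catalanQ : constantCoeff C = 1 := by
  rw [← coeff_zero_eq_constantCoeff_apply, catalanQ, coeff_map, catalanSeries_coeff]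
  simp

theorem labelSeries_dec_succ (m : ℕ) : labelSeries (.dec (m + 1)) =
    1 + X * (labelSeries (.dec (m + 2)) + labelSeries (.mid true m 0) +
      ∑ i ∈ Finset.range m, labelSeries (.gen true i 0 0)) := by
  ext d
  cases d with
  | zero => simp [labelSeries, labelCount]
  | succ d => simp [labelSeries, labelCount, coeff_one, coeff_succ_X_mul]

theorem labelSeries_mid (f : Bool) (m l : ℕ) : labelSeries (.mid f m l) =
    1 + X * (labelSeries (.gen f (m + 1) 0 l) +
      (labelSeries (.mid f m (l + 1)) + ∑ i ∈ Finset.range m, labelSeries (.gen f i (l + 1) 0)) +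
      ∑ x ∈ Finset.range (l + f.toNat), labelSeries (.mid false m (x + 1))) := by
  ext d
  cases d with
  | zero => simp [labelSeries, labelCount]
  | succ d => simp [labelSeries, labelCount, coeff_one, coeff_succ_X_mul]

theorem labelSeries_gen (f : Bool) (m p q : ℕ) : labelSeries (.gen f m p q) =
    1 + X * (labelSeries (.gen f (m + 1) 0 (p + q)) +
      ∑ i ∈ Finset.range (m + 1), labelSeries (.gen f i p 0) +
      (∑ x ∈ Finset.range (p + f.toNat), labelSeries (.gen false m (x + 1) q) +
      ∑ x ∈ Finset.range q, labelSeries (.gen false m 0 (x + 1)))) := by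
  ext d
  cases d with
  | zero => simp [labelSeries, labelCount]
  | succ d => simp [labelSeries, labelCount, coeff_one, coeff_succ_X_mul]

theorem X_mul_sum_catalanQ_pow (r s : ℕ) :
    X * ∑ x ∈ Finset.range r, C ^ (x + s + 2) = C ^ (s + r) - C ^ s := by
  induction r with
  | zero => simp
  | succ r ih =>
    rw [Finset.sum_range_succ]
    linear_combination ih + C ^ (s + r) * X_mul_catalanQ_sq

/-- With `s = m + q + 2`, the children have parameters `2, …, s + 1`, which is the Catalan tree. The
proof checks that `C ^ s` satisfies the recurrence, whose solution is unique. -/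
theorem labelSeries_gen_false_zero (m q : ℕ) : u m 0 q = C ^ (m + q + 2) := by
  have key : ∀ N m q, (X : ℚ⟦X⟧) ^ N ∣ u m 0 q - C ^ (m + q + 2) := by
    intro N
    induction N with
    | zero => simp
    | succ N ih =>
      intro m q
      have h1 := labelSeries_gen false m 0 q
      have h2 := X_mul_sum_catalanQ_pow (m + 1) 0
      have h3 := X_mul_sum_catalanQ_pow q (m + 1)
      -- The error is `X` times a sum of errors, so it is divisible by every power of `X`.
      have : u m 0 q - C ^ (m + q + 2) = X * ((u (m + 1) 0 q - C ^ (m + 1 + q + 2)) +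
          ∑ i ∈ Finset.range (m + 1), (u i 0 0 - C ^ (i + 0 + 2)) +
          ∑ x ∈ Finset.range q, (u m 0 (x + 1) - C ^ (m + (x + 1) + 2))) := by
        simp only [Finset.sum_sub_distrib]
        have e : ∀ x, m + (x + 1) + 2 = x + (m + 1) + 2 := fun x => by ring
        simp only [e]
        simp only [Bool.toNat_false, add_zero, zero_add, Finset.range_zero,
          Finset.sum_empty] at h1 h2
        linear_combination h1 + h2 + h3 + C ^ (m + q + 1) * X_mul_catalanQ_sq
      rw [this, pow_succ']
      refine mul_dvd_mul_left _ (dvd_add (dvd_add (ih _ _) ?_) ?_)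
      · exact Finset.dvd_sum fun i _ => ih _ _
      · exact Finset.dvd_sum fun i _ => ih _ _
  exact sub_eq_zero.1 (eq_zero_of_X_pow_dvd fun N => key N m q)

theorem labelSeries_gen_false_one (m : ℕ) :
    u m 1 0 = 1 + X * (C ^ (m + 4) + ∑ i ∈ Finset.range (m + 1), u i 1 0 + u m 1 0) := by
  have h := labelSeries_gen false m 1 0
  have h2 := labelSeries_gen_false_zero (m + 1) (1 + 0)
  dsimp only at h2 ⊢
  simp only [Bool.toNat_false, add_zero, zero_add, Finset.range_one, Finset.sum_singleton,
    Finset.range_zero, Finset.sum_empty] at h h2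
  linear_combination h + X * h2

/-- Subtracting the recurrence at `q = 0` cancels the sum over `i`, and all other terms are known
powers of `C` or the unknown itself. -/
theorem one_sub_X_mul_gen_false_one_sub (m q : ℕ) :
    (1 - X) * (u m 1 q - u m 1 0) = (C ^ q - 1) * (C ^ (m + 1) + X * C ^ (m + 4)) := by
  have h := labelSeries_gen false m 1 q
  have h1 := labelSeries_gen_false_one m
  have h2 := labelSeries_gen_false_zero (m + 1) (1 + q)
  have h3 := X_mul_sum_catalanQ_pow q (m + 1)
  have e : ∀ x, m + (x + 1) + 2 = x + (m + 1) + 2 := fun x => by ring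
  simp only [labelSeries_gen_false_zero m, e, Bool.toNat_false, add_zero, zero_add,
    Finset.range_one, Finset.sum_singleton] at h h1 h2 h3 ⊢
  linear_combination h - h1 + X * h2 + h3

theorem gen_true_zero_eq (m q : ℕ) :
    v m 0 q = 1 + X * (v (m + 1) 0 q + ∑ i ∈ Finset.range (m + 1), v i 0 0 + u m 1 q) +
      (C ^ (m + 1 + q) - C ^ (m + 1)) := by
  have h := labelSeries_gen true m 0 q
  have h3 := X_mul_sum_catalanQ_pow q (m + 1)
  have e : ∀ x, m + (x + 1) + 2 = x + (m + 1) + 2 := fun x => by ring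
  simp only [labelSeries_gen_false_zero m, e, Bool.toNat_true, zero_add,
    Finset.range_one, Finset.sum_singleton] at h h3 ⊢
  linear_combination h + h3

/-- The defect `y` satisfies `y m = X * y (m + 1)`, which forces it to vanish. -/
theorem one_sub_X_mul_gen_true_zero_sub (m q : ℕ) :
    (1 - X) * (v m 0 q - v m 0 0) = C ^ (m + 2) * (C ^ q - 1) * (1 + X ^ 2 * C ^ 3) := by
  set y : ℕ → ℚ⟦X⟧ := fun m =>
    (1 - X) * (v m 0 q - v m 0 0) - C ^ (m + 2) * (C ^ q - 1) * (1 + X ^ 2 * C ^ 3) with hy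
  have hstep : ∀ m, y m = X * y (m + 1) := fun m => by
    have h1 := gen_true_zero_eq m q
    have h2 := gen_true_zero_eq m 0
    have h3 := one_sub_X_mul_gen_false_one_sub m q
    simp only [hy] at h1 h2 h3 ⊢
    linear_combination (1 - X) * (h1 - h2) + X * h3 +
      C ^ (m + 1) * (C ^ q - 1) * (1 + X ^ 2 * C ^ 3) * X_mul_catalanQ_sq
  have key : ∀ N m, (X : ℚ⟦X⟧) ^ N ∣ y m := by
    intro N
    induction N with
    | zero => simp
    | succ N ih =>
      intro m
      rw [hstep, pow_succ']
      exact mul_dvd_mul_left _ (ih _)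
  exact sub_eq_zero.1 (eq_zero_of_X_pow_dvd fun N => key N m)

/-! ### The kernel method. -/

variable {w : ℚ⟦X⟧}

/-- The sum `∑ w ^ p * labelSeries (.gen f m p 0)`. -/
noncomputable def genSum (f : Bool) (w : ℚ⟦X⟧) (m : ℕ) : ℚ⟦X⟧ :=
  evalSeq w fun p => labelSeries (.gen f m p 0)

/-- The sum `∑ X ^ l * labelSeries (.gen true (m + 1) 0 l)`. -/
noncomputable def lastSum (m : ℕ) : ℚ⟦X⟧ := evalSeq X fun l => v (m + 1) 0 l

/-- The contribution to the node `mid f m l` of its children of type `gen`, summed over `l`. -/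
noncomputable def sourceSum (f : Bool) (w : ℚ⟦X⟧) (m : ℕ) : ℚ⟦X⟧ :=
  evalSeq w fun l => labelSeries (.gen f (m + 1) 0 l) +
    ∑ i ∈ Finset.range m, labelSeries (.gen f i (l + 1) 0)

theorem catalanQ_mul_one_sub : C * (1 - X * C) = 1 := by
  linear_combination -X_mul_catalanQ_sq

theorem evalSeq_X_catalanQ_pow (k : ℕ) : evalSeq X (fun m => C ^ (m + k)) = C ^ (k + 1) := by
  linear_combination C * one_sub_mul_evalSeq_pow (dvd_refl X) C k -
    evalSeq X (fun m => C ^ (m + k)) * catalanQ_mul_one_sub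

theorem evalSeq_gen_false_one (hw : X ∣ w) :
    (1 - w) * (1 - w * C) * (1 - X) * evalSeq w (fun m => u m 1 0) =
      (1 - w * C) + X * ((1 - w) * C ^ 4 + (1 - w * C) * evalSeq w fun m => u m 1 0) := by
  have h := congrArg (evalSeq w) (funext labelSeries_gen_false_one)
  simp only [evalSeq_add, evalSeq_mul hw] at h ⊢
  linear_combination (1 - w) * (1 - w * C) * h +
    (1 - w * C) * one_sub_mul_evalSeq_const hw 1 +
    X * (1 - w) * one_sub_mul_evalSeq_pow hw C 4 +
    X * (1 - w * C) * one_sub_mul_evalSeq_sum_range_succ hw fun m => u m 1 0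

/-- The unknown sum has coefficient `w - w ^ 2 - X`. At `w = X * C` this is zero, which yields `v 0
0 0`; at `w = X` it is `-X ^ 2`, which then yields the sum. -/
theorem evalSeq_gen_true_zero (hw : X ∣ w) :
    w * (1 - w) * evalSeq w (fun m => v m 0 0) =
      w + X * ((1 - w) * (evalSeq w (fun m => v m 0 0) - v 0 0 0) +
        w * evalSeq w (fun m => v m 0 0) + w * (1 - w) * evalSeq w fun m => u m 1 0) := by
  have h' : ∀ m, v m 0 0 =
      1 + X * (v (m + 1) 0 0 + ∑ i ∈ Finset.range (m + 1), v i 0 0 + u m 1 0) := fun m => by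
    have := gen_true_zero_eq m 0
    dsimp only at this ⊢
    linear_combination this
  have h := congrArg (evalSeq w) (funext h')
  simp only [evalSeq_add, evalSeq_mul hw] at h ⊢
  linear_combination w * (1 - w) * h + w * one_sub_mul_evalSeq_const hw 1 -
    X * (1 - w) * evalSeq_succ hw (fun m => v m 0 0) +
    X * w * one_sub_mul_evalSeq_sum_range_succ hw fun m => v m 0 0

theorem genSum_false_sub (hw : X ∣ w) (m : ℕ) :
    genSum false w m - C ^ (m + 2) = w * evalSeq w fun l => u m (l + 1) 0 := by
  rw [genSum, evalSeq_succ hw]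
  have := labelSeries_gen_false_zero m 0
  dsimp only at this ⊢
  rw [this]
  ring

theorem genSum_false (hw : X ∣ w) (m : ℕ) :
    (1 - w) * (1 - w * C) * genSum false w m + X * (1 - w * C) * C ^ (m + 2) =
      (1 - w * C) + X * (1 - w) * C ^ (m + 3) +
        X * (1 - w) * (1 - w * C) * ∑ i ∈ Finset.range (m + 1), genSum false w i +
        X * (1 - w * C) * genSum false w m := by
  have h' : ∀ p, u m p 0 = 1 + X * (C ^ (p + (m + 3)) +
      ∑ i ∈ Finset.range (m + 1), u i p 0 + ∑ x ∈ Finset.range p, u m (x + 1) 0) := fun p => by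
    have h1 := labelSeries_gen false m p 0
    have h2 := labelSeries_gen_false_zero (m + 1) (p + 0)
    simp only [Bool.toNat_false, add_zero, Finset.range_zero, Finset.sum_empty] at h1 h2 ⊢
    linear_combination h1 + X * h2
  have h := congrArg (evalSeq w) (funext h')
  simp only [evalSeq_add, evalSeq_mul hw, evalSeq_sum] at h
  have h1 := genSum_false_sub hw m
  simp only [genSum] at h1 ⊢
  linear_combination (1 - w) * (1 - w * C) * h +
    (1 - w * C) * one_sub_mul_evalSeq_const hw 1 +
    X * (1 - w) * one_sub_mul_evalSeq_pow hw C (m + 3) - X * (1 - w * C) * h1 +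
    X * (1 - w * C) * one_sub_mul_evalSeq_sum_range hw fun x => u m (x + 1) 0

theorem evalSeq_genSum_false (hw : X ∣ w) :
    (1 - w) * (1 - w * C) * (1 - X) * evalSeq X (genSum false w) +
        X * (1 - X) * (1 - w * C) * C ^ 3 =
      (1 - w * C) + X * (1 - w) * (1 - X) * C ^ 4 +
        X * (1 - w) * (1 - w * C) * evalSeq X (genSum false w) +
        X * (1 - X) * (1 - w * C) * evalSeq X (genSum false w) := by
  have hX := dvd_refl (X : ℚ⟦X⟧)
  have h := congrArg (evalSeq X) (funext (genSum_false hw))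
  simp only [evalSeq_add, evalSeq_mul hX, evalSeq_X_catalanQ_pow] at h
  linear_combination (1 - X) * h + one_sub_mul_evalSeq_const hX (1 - w * C) +
    X * (1 - w) * (1 - w * C) * one_sub_mul_evalSeq_sum_range_succ hX (genSum false w)

/-- The dependence of `v (m + 1) 0 l` on `l` is explicit through `C ^ l`, so the sum reduces to
geometric series and `v (m + 1) 0 0`. -/
theorem lastSum_eq (m : ℕ) : (1 - X) ^ 2 * lastSum m =
    (1 - X) * v (m + 1) 0 0 + ((1 + X ^ 2 * C ^ 3) * ((1 - X) * C - 1)) * C ^ (m + 3) := by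
  have hX := dvd_refl (X : ℚ⟦X⟧)
  have h' : ∀ l, (1 - X) * v (m + 1) 0 l = (1 - X) * v (m + 1) 0 0 +
      (C ^ (m + 3) * (1 + X ^ 2 * C ^ 3)) * (C ^ (l + 0) - 1) := fun l => by
    have := one_sub_X_mul_gen_true_zero_sub (m + 1) l
    dsimp only at this ⊢
    linear_combination this
  have h := congrArg (evalSeq X) (funext h')
  simp only [evalSeq_add, evalSeq_sub, evalSeq_mul hX] at h
  rw [evalSeq_X_catalanQ_pow] at h
  rw [lastSum]
  dsimp only at h ⊢
  linear_combination (1 - X) * h +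
    (1 - X) * one_sub_mul_evalSeq_const hX (v (m + 1) 0 0) -
    (C ^ (m + 3) * (1 + X ^ 2 * C ^ 3)) * one_sub_mul_evalSeq_const hX 1

theorem evalSeq_lastSum : X * (1 - X) ^ 2 * evalSeq X lastSum =
    (1 - X) * (evalSeq X (fun m => v m 0 0) - v 0 0 0) +
      X * ((1 + X ^ 2 * C ^ 3) * ((1 - X) * C - 1)) * C ^ 4 := by
  have hX := dvd_refl (X : ℚ⟦X⟧)
  have h := congrArg (evalSeq X) (funext lastSum_eq)
  simp only [evalSeq_add, evalSeq_mul hX, evalSeq_X_catalanQ_pow] at h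
  have h1 := evalSeq_succ hX fun m => v m 0 0
  dsimp only at h1 ⊢
  linear_combination X * h - (1 - X) * h1

theorem sourceSum_false (hw : X ∣ w) (m : ℕ) : w * (1 - w * C) * sourceSum false w m =
    (1 - w * C) * ∑ i ∈ Finset.range m, (genSum false w i - C ^ (i + 2)) + w * C ^ (m + 3) := by
  have h : ∀ l, u (m + 1) 0 l = C ^ (l + (m + 3)) := fun l => by
    rw [labelSeries_gen_false_zero]
    ring
  simp only at h
  simp only [sourceSum, h, evalSeq_add, evalSeq_sum, genSum_false_sub hw]
  rw [← Finset.mul_sum]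
  linear_combination w * one_sub_mul_evalSeq_pow hw C (m + 3)

theorem evalSeq_sourceSum_false (hw : X ∣ w) :
    w * (1 - w * C) * (1 - X) * evalSeq X (sourceSum false w) =
      (1 - w * C) * X * (evalSeq X (genSum false w) - C ^ 3) + w * (1 - X) * C ^ 4 := by
  have hX := dvd_refl (X : ℚ⟦X⟧)
  have h := congrArg (evalSeq X) (funext (sourceSum_false hw))
  have h1 := one_sub_mul_evalSeq_sum_range hX fun i => genSum false w i - C ^ (i + 2)
  simp only [evalSeq_add, evalSeq_sub, evalSeq_mul hX, evalSeq_X_catalanQ_pow] at h h1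
  linear_combination (1 - X) * h + (1 - w * C) * h1

theorem genSum_true (m : ℕ) : (1 - X) * genSum true X m =
    1 + X * (1 - X) * lastSum m + X * (1 - X) * ∑ i ∈ Finset.range (m + 1), genSum true X i +
      (genSum false X m - C ^ (m + 2)) := by
  have hX := dvd_refl (X : ℚ⟦X⟧)
  have h' : ∀ p, v m p 0 = 1 + X * (v (m + 1) 0 p +
      ∑ i ∈ Finset.range (m + 1), v i p 0 + ∑ x ∈ Finset.range (p + 1), u m (x + 1) 0) :=
    fun p => by
      have h1 := labelSeries_gen true m p 0
      simp only [Bool.toNat_true, add_zero, Finset.range_zero, Finset.sum_empty] at h1 ⊢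
      linear_combination h1
  have h := congrArg (evalSeq X) (funext h')
  have h1 := one_sub_mul_evalSeq_sum_range_succ hX fun x => u m (x + 1) 0
  simp only [evalSeq_add, evalSeq_mul hX] at h
  rw [evalSeq_sum] at h
  rw [genSum_false_sub hX]
  simp only [genSum, lastSum]
  linear_combination (1 - X) * h + one_sub_mul_evalSeq_const hX 1 + X * h1

theorem evalSeq_genSum_true : (1 - X) ^ 2 * evalSeq X (genSum true X) =
    1 + X * (1 - X) ^ 2 * evalSeq X lastSum + X * (1 - X) * evalSeq X (genSum true X) +
      (1 - X) * (evalSeq X (genSum false X) - C ^ 3) := by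
  have hX := dvd_refl (X : ℚ⟦X⟧)
  have h := congrArg (evalSeq X) (funext genSum_true)
  simp only [evalSeq_add, evalSeq_sub, evalSeq_mul hX, evalSeq_X_catalanQ_pow] at h
  linear_combination (1 - X) * h + one_sub_mul_evalSeq_const hX 1 +
    X * (1 - X) * one_sub_mul_evalSeq_sum_range_succ hX (genSum true X)

theorem sourceSum_true (m : ℕ) : X * sourceSum true X m =
    ∑ i ∈ Finset.range m, (genSum true X i - v i 0 0) + X * lastSum m := by
  have hX := dvd_refl (X : ℚ⟦X⟧)
  have h : ∀ i, genSum true X i - v i 0 0 = X * evalSeq X fun l => v i (l + 1) 0 := fun i => by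
    rw [genSum, evalSeq_succ hX]
    ring
  simp only at h
  simp only [sourceSum, lastSum, evalSeq_add, evalSeq_sum, h]
  rw [← Finset.mul_sum]
  ring

theorem evalSeq_sourceSum_true : (1 - X) * evalSeq X (sourceSum true X) =
    evalSeq X (genSum true X) - evalSeq X (fun m => v m 0 0) +
      (1 - X) * evalSeq X lastSum := by
  have hX := dvd_refl (X : ℚ⟦X⟧)
  have h := congrArg (evalSeq X) (funext sourceSum_true)
  have h1 := one_sub_mul_evalSeq_sum_range hX fun i => genSum true X i - v i 0 0
  simp only [evalSeq_add, evalSeq_sub, evalSeq_mul hX] at h h1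
  refine mul_left_cancel₀ (X_ne_zero (R := ℚ)) ?_
  linear_combination (1 - X) * h + h1

/-- The sum over `mid false m (l + 1)` again has coefficient `w - w ^ 2 - X`, with root `w = X * C`.
-/
theorem evalSeq_mid_false (hw : X ∣ w) (m : ℕ) :
    (1 - w) * (labelSeries (.mid false m 0) +
        w * evalSeq w fun l => labelSeries (.mid false m (l + 1))) =
      1 + X * ((1 - w) * (sourceSum false w m +
        evalSeq w fun l => labelSeries (.mid false m (l + 1))) +
        w * evalSeq w fun l => labelSeries (.mid false m (l + 1))) := by
  have h := congrArg (evalSeq w) (funext (labelSeries_mid false m))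
  have h1 := evalSeq_succ hw fun l => labelSeries (.mid false m l)
  have h2 := one_sub_mul_evalSeq_sum_range hw fun l => labelSeries (.mid false m (l + 1))
  simp only [sourceSum, Bool.toNat_false, add_zero, evalSeq_add, evalSeq_mul hw] at h ⊢
  linear_combination (1 - w) * h - (1 - w) * h1 + one_sub_mul_evalSeq_const hw 1 + X * h2

theorem X_dvd_X_mul_catalanQ : (X : ℚ⟦X⟧) ∣ X * C := dvd_mul_right _ _

/-- At `w = X` the shift in `l` cancels and isolates `mid true m 0`. The sum over `mid false` that
is left comes from `evalSeq_mid_false` at `w = X`, once `mid false m 0` is known. -/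
theorem X_mul_labelSeries_mid_true (m : ℕ) : X * labelSeries (.mid true m 0) =
    C - 1 + X * sourceSum false (X * C) m - X * sourceSum false X m +
      X ^ 2 * sourceSum true X m := by
  have hX := dvd_refl (X : ℚ⟦X⟧)
  have h := congrArg (evalSeq X) (funext (labelSeries_mid true m))
  have h1 := evalSeq_succ hX fun l => labelSeries (.mid true m l)
  have h2 := one_sub_mul_evalSeq_sum_range_succ hX fun l => labelSeries (.mid false m (l + 1))
  have h3 := evalSeq_mid_false hX m
  have h4 := evalSeq_mid_false X_dvd_X_mul_catalanQ m
  have h5 := one_sub_mul_evalSeq_const hX 1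
  -- At `w = X * C` the kernel vanishes and the sum disappears.
  have h6 : labelSeries (.mid false m 0) = C + X * sourceSum false (X * C) m := by
    linear_combination C * h4 + (labelSeries (.mid false m 0) +
      X * C * (evalSeq (X * C) fun l => labelSeries (.mid false m (l + 1))) -
      X * (sourceSum false (X * C) m +
        evalSeq (X * C) fun l => labelSeries (.mid false m (l + 1)))) * -catalanQ_mul_one_sub +
      (X * evalSeq (X * C) fun l => labelSeries (.mid false m (l + 1))) * X_mul_catalanQ_sq
  have h7 : (1 - X : ℚ⟦X⟧) ≠ 0 := fun h => by
    simpa using congrArg constantCoeff h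
  refine mul_left_cancel₀ h7 ?_
  simp only [sourceSum, Bool.toNat_true, evalSeq_add, evalSeq_mul hX] at h h1 h3 h6 ⊢
  linear_combination X * (1 - X) * (h - h1) + X * h5 + X ^ 2 * h2 - h3 + (1 - X) * h6

/-- Summing over `m` with weight `X ^ m` telescopes the `dec` series down to the first one. This is
why every sum over `m` is needed at `X`. -/
theorem labelSeries_dec_one : (1 - X) * labelSeries (.dec 1) =
    C + (1 - X) * (X * evalSeq X (sourceSum false (X * C)) - X * evalSeq X (sourceSum false X) +
      X ^ 2 * evalSeq X (sourceSum true X)) + X ^ 2 * evalSeq X fun m => v m 0 0 := by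
  have hX := dvd_refl (X : ℚ⟦X⟧)
  have h := congrArg (evalSeq X) (funext labelSeries_dec_succ)
  have h1 := evalSeq_succ hX fun m => labelSeries (.dec (m + 1))
  have h2 := congrArg (evalSeq X) (funext X_mul_labelSeries_mid_true)
  have h3 := one_sub_mul_evalSeq_sum_range hX fun m => v m 0 0
  have h4 := one_sub_mul_evalSeq_const hX 1
  have h5 := one_sub_mul_evalSeq_const hX C
  simp only [evalSeq_add, evalSeq_sub, evalSeq_mul hX, zero_add] at h h1 h2 ⊢
  linear_combination (1 - X) * (h - h1) + (1 - X) * h2 + X * h3 + h5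

/-! ### Solving the linear system in terms of `C`. -/

set_option linter.unusedSimpArgs false in
-- The suffixes `z` and `c` in `Bz`, `Bc`, `Gz`, `Gc` mark sums at `w = X` and `w = X * C`; `V'` is
-- the sum that the kernel eliminates. The system is triangular: each unknown in turn has a nonzero
-- coefficient and a right side already known.
theorem kernel_system_solution {K : Type*} [Field K] {z c Bz Bc H V Gz Gc L G S T S' e : K}
    (hz : z * c ^ 2 = c - 1) (h0 : c ≠ 0) (h1 : c - 1 ≠ 0) (p1 : c ^ 2 - c + 1 ≠ 0)
    (p2 : 2 - c ≠ 0) (p3 : c ^ 4 - 3 * c ^ 3 + 4 * c ^ 2 - 2 * c + 1 ≠ 0)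
    (p4 : c ^ 2 - 3 * c + 3 ≠ 0) (p5 : c ^ 2 - 2 * c + 2 ≠ 0)
    (eBz : (1 - z) * (1 - z * c) * (1 - z) * Bz =
      (1 - z * c) + z * ((1 - z) * c ^ 4 + (1 - z * c) * Bz))
    (eBc : (1 - z * c) * (1 - z * c * c) * (1 - z) * Bc =
      (1 - z * c * c) + z * ((1 - z * c) * c ^ 4 + (1 - z * c * c) * Bc))
    {V' : K}
    (eH : z * c * (1 - z * c) * V' =
      z * c + z * ((1 - z * c) * (V' - H) + z * c * V' + z * c * (1 - z * c) * Bc))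
    (eV : z * (1 - z) * V = z + z * ((1 - z) * (V - H) + z * V + z * (1 - z) * Bz))
    (eGz : (1 - z) * (1 - z * c) * (1 - z) * Gz + z * (1 - z) * (1 - z * c) * c ^ 3 =
      (1 - z * c) + z * (1 - z) * (1 - z) * c ^ 4 + z * (1 - z) * (1 - z * c) * Gz +
        z * (1 - z) * (1 - z * c) * Gz)
    (eGc : (1 - z * c) * (1 - z * c * c) * (1 - z) * Gc +
        z * (1 - z) * (1 - z * c * c) * c ^ 3 =
      (1 - z * c * c) + z * (1 - z * c) * (1 - z) * c ^ 4 +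
        z * (1 - z * c) * (1 - z * c * c) * Gc + z * (1 - z) * (1 - z * c * c) * Gc)
    (eL : z * (1 - z) ^ 2 * L = (1 - z) * (V - H) +
      z * ((1 + z ^ 2 * c ^ 3) * ((1 - z) * c - 1)) * c ^ 4)
    (eG : (1 - z) ^ 2 * G = 1 + z * (1 - z) ^ 2 * L + z * (1 - z) * G + (1 - z) * (Gz - c ^ 3))
    (eS : z * (1 - z * c) * (1 - z) * S = (1 - z * c) * z * (Gz - c ^ 3) + z * (1 - z) * c ^ 4)
    (eT : z * c * (1 - z * c * c) * (1 - z) * T =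
      (1 - z * c * c) * z * (Gc - c ^ 3) + z * c * (1 - z) * c ^ 4)
    (eS' : (1 - z) * S' = G - V + (1 - z) * L)
    (ee : (1 - z) * e = c + (1 - z) * (z * T - z * S + z ^ 2 * S') + z ^ 2 * V) :
    e * ((2 - c) * (c ^ 4 - 3 * c ^ 3 + 4 * c ^ 2 - 2 * c + 1)) =
      2 * c ^ 9 - 9 * c ^ 8 + 17 * c ^ 7 - 16 * c ^ 6 + 6 * c ^ 5 + 2 * c ^ 4 - 3 * c ^ 3 +
        2 * c ^ 2 := by
  -- The factors of the denominators stay opaque while fractions are cleared and are expanded only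
  -- before `ring`.
  obtain ⟨d1, hd1⟩ : ∃ d, d = c ^ 2 - c + 1 := ⟨_, rfl⟩
  obtain ⟨d2, hd2⟩ : ∃ d, d = 2 - c := ⟨_, rfl⟩
  obtain ⟨d3, hd3⟩ : ∃ d, d = c ^ 4 - 3 * c ^ 3 + 4 * c ^ 2 - 2 * c + 1 := ⟨_, rfl⟩
  obtain ⟨d4, hd4⟩ : ∃ d, d = c ^ 2 - 3 * c + 3 := ⟨_, rfl⟩
  obtain ⟨d5, hd5⟩ : ∃ d, d = c ^ 2 - 2 * c + 2 := ⟨_, rfl⟩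
  rw [← hd1] at p1
  rw [← hd2] at p2 ⊢
  rw [← hd3] at p3 ⊢
  rw [← hd4] at p4
  rw [← hd5] at p5
  have hz₀ := hz
  replace hz : z = (c - 1) / c ^ 2 := by field_simp; exact hz
  have solve : ∀ {A A' x R y : K}, A = A' → A' ≠ 0 → A * x = R → A * y = R → x = y :=
    fun hA hA' h h' => mul_left_cancel₀ (hA ▸ hA') (h.trans h'.symm)
  have hBz : Bz = (c ^ 8 - 2 * c ^ 7 + 2 * c ^ 6 - c ^ 5 + c ^ 4) / d3 := by
    refine solve (A := (1 - z) * (1 - z * c) * (1 - z) - z * (1 - z * c)) (A' := d3 / c ^ 5)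
      (R := (1 - z * c) + z * ((1 - z) * c ^ 4)) ?_ ?_ ?_ ?_
    · rw [hz]; field_simp; simp only [hd1, hd2, hd3, hd4, hd5]; ring
    · simp [h0, p3]
    · linear_combination eBz
    · rw [hz]; field_simp; simp only [hd1, hd2, hd3, hd4, hd5]; ring
  have hBc : Bc = (c ^ 5 - 2 * c ^ 4 + 2 * c ^ 3) / d2 := by
    refine solve (A := (1 - z * c) * (1 - z * c * c) * (1 - z) - z * (1 - z * c * c)) (A' := d2 / c ^ 3)
      (R := (1 - z * c * c) + z * ((1 - z * c) * c ^ 4)) ?_ ?_ ?_ ?_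
    · rw [hz]; field_simp; simp only [hd1, hd2, hd3, hd4, hd5]; ring
    · simp [h0, p2]
    · linear_combination eBc
    · rw [hz]; field_simp; simp only [hd1, hd2, hd3, hd4, hd5]; ring
  have hH : H = (c ^ 5 - 3 * c ^ 4 + 3 * c ^ 3) / d2 := by
    refine solve (A := z * (1 - z * c)) (A' := (c - 1) / c ^ 3)
      (R := z * c + z * (z * c * (1 - z * c) * Bc)) ?_ ?_ ?_ ?_
    · rw [hz]; field_simp; ring
    · simp [h0, h1]
    -- The coefficient of `V'` is a multiple of the equation for `c`, so `V'` drops out.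
    · linear_combination eH + z * V' * hz₀
    · rw [hBc, hz]; field_simp; simp only [hd1, hd2, hd3, hd4, hd5]; ring
  have hV : V = (c ^ 10 - 5 * c ^ 9 + 12 * c ^ 8 - 17 * c ^ 7 + 16 * c ^ 6 - 11 * c ^ 5 + 6 * c ^ 4 - c ^ 3) /
      (d2 * d3) := by
    refine solve (A := -z ^ 2) (A' := -(c - 1) ^ 2 / c ^ 4)
      (R := z + z * (z * (1 - z) * Bz - (1 - z) * H)) ?_ ?_ ?_ ?_
    · rw [hz]; field_simp
    · simp [h0, h1]
    · linear_combination eV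
    · rw [hBz, hH, hz]; field_simp; simp only [hd1, hd2, hd3, hd4, hd5]; ring
  have hGz : Gz = (c ^ 8 - 3 * c ^ 7 + 4 * c ^ 6 - 3 * c ^ 5 + 2 * c ^ 4) /
      (d1 * d4) := by
    refine solve (A := (1 - z) * (1 - z * c) * (1 - z) - 2 * (z * (1 - z) * (1 - z * c))) (A' := d1 * d4 / c ^ 5)
      (R := (1 - z * c) + z * (1 - z) * (1 - z) * c ^ 4 - z * (1 - z) * (1 - z * c) * c ^ 3) ?_ ?_ ?_ ?_
    · rw [hz]; field_simp; simp only [hd1, hd2, hd3, hd4, hd5]; ring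
    · simp [h0, p1, p4]
    · linear_combination eGz
    · rw [hz]; field_simp; simp only [hd1, hd2, hd3, hd4, hd5]; ring
  have hGc : Gc = (c ^ 7 - 3 * c ^ 6 + 3 * c ^ 5 - c ^ 4 + c ^ 3) / d2 := by
    refine solve (A := (1 - z * c) * (1 - z * c * c) * (1 - z) -
      z * (1 - z * c) * (1 - z * c * c) - z * (1 - z) * (1 - z * c * c)) (A' := d2 / c ^ 4)
      (R := (1 - z * c * c) + z * (1 - z * c) * (1 - z) * c ^ 4 - z * (1 - z) * (1 - z * c * c) * c ^ 3) ?_ ?_ ?_ ?_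
    · rw [hz]; field_simp; simp only [hd1, hd2, hd3, hd4, hd5]; ring
    · simp [h0, p2]
    · linear_combination eGc
    · rw [hz]; field_simp; simp only [hd1, hd2, hd3, hd4, hd5]; ring
  have hL : L = (2 * c ^ 12 - 8 * c ^ 11 + 15 * c ^ 10 - 16 * c ^ 9 + 11 * c ^ 8 - 5 * c ^ 7 + 2 * c ^ 6) /
      (d1 * d2 * d3) := by
    refine solve (A := z * (1 - z) ^ 2) (A' := (c - 1) * d1 ^ 2 / c ^ 6)
      (R := (1 - z) * (V - H) + z * ((1 + z ^ 2 * c ^ 3) * ((1 - z) * c - 1)) * c ^ 4) ?_ ?_ ?_ ?_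
    · rw [hz]; field_simp; simp only [hd1, hd2, hd3, hd4, hd5]; ring
    · simp [h0, h1, p1]
    · linear_combination eL
    · rw [hV, hH, hz]; field_simp; simp only [hd1, hd2, hd3, hd4, hd5]; ring
  have hG : G = (c ^ 13 - 7 * c ^ 12 + 23 * c ^ 11 - 45 * c ^ 10 + 58 * c ^ 9 - 50 * c ^ 8 + 28 * c ^ 7 -
      10 * c ^ 6 + 3 * c ^ 5) / (d1 * d2 * d3 * d4) := by
    refine solve (A := (1 - z) ^ 2 - z * (1 - z)) (A' := d1 * d5 / c ^ 4)
      (R := 1 + z * (1 - z) ^ 2 * L + (1 - z) * (Gz - c ^ 3)) ?_ ?_ ?_ ?_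
    · rw [hz]; field_simp; simp only [hd1, hd2, hd3, hd4, hd5]; ring
    · simp [h0, p1, p5]
    · linear_combination eG
    · rw [hL, hGz, hz]; field_simp; simp only [hd1, hd2, hd3, hd4, hd5]; ring
  have hS : S = (c ^ 11 - 4 * c ^ 10 + 8 * c ^ 9 - 9 * c ^ 8 + 6 * c ^ 7 - c ^ 6) /
      (d1 ^ 2 * d4) := by
    refine solve (A := z * (1 - z * c) * (1 - z)) (A' := (c - 1) * d1 / c ^ 5)
      (R := (1 - z * c) * z * (Gz - c ^ 3) + z * (1 - z) * c ^ 4) ?_ ?_ ?_ ?_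
    · rw [hz]; field_simp; simp only [hd1, hd2, hd3, hd4, hd5]; ring
    · simp [h0, h1, p1]
    · linear_combination eS
    · rw [hGz, hz]; field_simp; simp only [hd1, hd2, hd3, hd4, hd5]; ring
  have hT : T = (c ^ 8 - 3 * c ^ 7 + 4 * c ^ 6 - c ^ 5) / (d1 * d2) := by
    refine solve (A := z * c * (1 - z * c * c) * (1 - z)) (A' := (c - 1) * d1 * d2 / c ^ 3)
      (R := (1 - z * c * c) * z * (Gc - c ^ 3) + z * c * (1 - z) * c ^ 4) ?_ ?_ ?_ ?_
    · rw [hz]; field_simp; simp only [hd1, hd2, hd3, hd4, hd5]; ring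
    · simp [h0, h1, p1, p2]
    · linear_combination eT
    · rw [hGc, hz]; field_simp; simp only [hd1, hd2, hd3, hd4, hd5]; ring
  have hS₁ : S' = (c ^ 16 - 6 * c ^ 15 + 15 * c ^ 14 - 15 * c ^ 13 - 12 * c ^ 12 + 64 * c ^ 11 -
      110 * c ^ 10 + 120 * c ^ 9 - 93 * c ^ 8 + 52 * c ^ 7 - 18 * c ^ 6 + 3 * c ^ 5) /
      (d1 ^ 2 * d2 * d3 * d4) := by
    refine solve (A := 1 - z) (A' := d1 / c ^ 2)
      (R := G - V + (1 - z) * L) ?_ ?_ ?_ ?_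
    · rw [hz]; field_simp; simp only [hd1, hd2, hd3, hd4, hd5]; ring
    · simp [h0, p1]
    · linear_combination eS'
    · rw [hG, hV, hL, hz]; field_simp; simp only [hd1, hd2, hd3, hd4, hd5]; ring
  have he : e = (2 * c ^ 9 - 9 * c ^ 8 + 17 * c ^ 7 - 16 * c ^ 6 + 6 * c ^ 5 + 2 * c ^ 4 - 3 * c ^ 3 +
      2 * c ^ 2) / (d2 * d3) := by
    refine solve (A := 1 - z) (A' := d1 / c ^ 2)
      (R := c + (1 - z) * (z * T - z * S + z ^ 2 * S') + z ^ 2 * V) ?_ ?_ ?_ ?_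
    · rw [hz]; field_simp; simp only [hd1, hd2, hd3, hd4, hd5]; ring
    · simp [h0, p1]
    · linear_combination ee
    · rw [hT, hS, hS₁, hV, hz]; field_simp; simp only [hd1, hd2, hd3, hd4, hd5]; ring
  rw [he]
  field_simp

theorem ne_zero_of_constantCoeff {x : ℚ⟦X⟧} (h : constantCoeff x ≠ 0) : x ≠ 0 := by
  rintro rfl
  simp at h

theorem labelSeries_dec_one_mul : labelSeries (.dec 1) *
    ((2 - C) * (C ^ 4 - 3 * C ^ 3 + 4 * C ^ 2 - 2 * C + 1)) =
      2 * C ^ 9 - 9 * C ^ 8 + 17 * C ^ 7 - 16 * C ^ 6 + 6 * C ^ 5 + 2 * C ^ 4 - 3 * C ^ 3 +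
        2 * C ^ 2 := by
  have hinj := IsFractionRing.injective ℚ⟦X⟧ (FractionRing ℚ⟦X⟧)
  have ne : ∀ x : ℚ⟦X⟧, x ≠ 0 → algebraMap ℚ⟦X⟧ (FractionRing ℚ⟦X⟧) x ≠ 0 :=
    fun x hx h => hx (hinj (by rw [h, map_zero]))
  have hX := dvd_refl (X : ℚ⟦X⟧)
  have hC := X_dvd_X_mul_catalanQ
  have c1 := constantCoeff_catalanQ
  have hC1 : C - 1 ≠ 0 := by
    rw [← X_mul_catalanQ_sq]
    exact mul_ne_zero X_ne_zero (pow_ne_zero _ (ne_zero_of_constantCoeff (by simp [c1])))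
  have q0 := ne C (ne_zero_of_constantCoeff (by simp [c1]))
  have q1 := ne _ hC1
  -- `C` has constant term `1`, and each of these polynomials takes the value `1` there.
  have p1 := ne (C ^ 2 - C + 1) (ne_zero_of_constantCoeff (by simp [c1]))
  have p2 := ne (2 - C) (ne_zero_of_constantCoeff (by simp [c1, map_ofNat]; try norm_num))
  have p3 := ne (C ^ 4 - 3 * C ^ 3 + 4 * C ^ 2 - 2 * C + 1)
    (ne_zero_of_constantCoeff (by simp [c1, map_ofNat]; try norm_num))
  have p4 := ne (C ^ 2 - 3 * C + 3) (ne_zero_of_constantCoeff (by simp [c1, map_ofNat]))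
  have p5 := ne (C ^ 2 - 2 * C + 2) (ne_zero_of_constantCoeff (by simp [c1, map_ofNat]))
  have map {x y : ℚ⟦X⟧} (h : x = y) := congrArg (algebraMap ℚ⟦X⟧ (FractionRing ℚ⟦X⟧)) h
  have hz := map X_mul_catalanQ_sq
  have e1 := map (evalSeq_gen_false_one hX)
  have e2 := map (evalSeq_gen_false_one hC)
  have e3 := map (evalSeq_gen_true_zero hC)
  have e4 := map (evalSeq_gen_true_zero hX)
  have e5 := map (evalSeq_genSum_false hX)
  have e6 := map (evalSeq_genSum_false hC)
  have e7 := map evalSeq_lastSum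
  have e8 := map evalSeq_genSum_true
  have e9 := map (evalSeq_sourceSum_false hX)
  have e10 := map (evalSeq_sourceSum_false hC)
  have e11 := map evalSeq_sourceSum_true
  have e12 := map labelSeries_dec_one
  simp only [map_add, map_sub, map_mul, map_pow, map_one, map_ofNat] at hz q1 p1 p2 p3 p4 p5
  simp only [map_add, map_sub, map_mul, map_pow, map_one] at e1 e2 e3 e4 e5 e6 e7 e8 e9 e10 e11 e12
  have := kernel_system_solution hz q0 q1 p1 p2 p3 p4 p5 e1 e2 e3 e4 e5 e6 e7 e8 e9 e10 e11 e12
  apply hinj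
  simpa only [map_add, map_sub, map_mul, map_pow, map_one, map_ofNat] using this

/-! ### The closed form and algebraicity. -/

theorem sqrtOneSubFour_eq : sqrtOneSubFour = 1 - 2 * X * C := by
  have h : (sqrtOneSubFour - (1 - 2 * X * C)) * (sqrtOneSubFour + (1 - 2 * X * C)) = 0 := by
    linear_combination sqrtOneSubFour_sq - 4 * X * X_mul_catalanQ_sq
  rcases mul_eq_zero.1 h with h | h
  · exact sub_eq_zero.1 h
  · refine absurd h (ne_zero_of_constantCoeff ?_)
    simp [constantCoeff_sqrtOneSubFour]

theorem genFun_eq : genFun (Av {p1234, p2341}) = X * labelSeries (.dec 1) := by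
  ext n
  cases n with
  | zero => simp [genFun, count_zero]
  | succ n => simp [genFun, coeff_succ_X_mul, count_eq_labelCount, labelCount, labelSeries]

theorem genFun_mul_denom : genFun (Av {p1234, p2341}) * denom = numer := by
  have hinj := IsFractionRing.injective ℚ⟦X⟧ (FractionRing ℚ⟦X⟧)
  have c1 := constantCoeff_catalanQ
  have h := congrArg (algebraMap ℚ⟦X⟧ (FractionRing ℚ⟦X⟧)) labelSeries_dec_one_mul
  have hz := congrArg (algebraMap ℚ⟦X⟧ (FractionRing ℚ⟦X⟧)) X_mul_catalanQ_sq
  have h0 : algebraMap ℚ⟦X⟧ (FractionRing ℚ⟦X⟧) C ≠ 0 := fun h =>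
    ne_zero_of_constantCoeff (x := C) (by simp [c1]) (hinj (by rw [h, map_zero]))
  apply hinj
  rw [genFun_eq]
  simp only [denom, numer, sqrtOneSubFour_eq, map_add, map_sub, map_mul, map_pow, map_one,
    map_ofNat] at h hz ⊢
  generalize algebraMap ℚ⟦X⟧ (FractionRing ℚ⟦X⟧) C = c at *
  generalize algebraMap ℚ⟦X⟧ (FractionRing ℚ⟦X⟧) X = z at *
  generalize algebraMap ℚ⟦X⟧ (FractionRing ℚ⟦X⟧) (labelSeries (.dec 1)) = e at *
  obtain rfl : z = (c - 1) / c ^ 2 := by field_simp; exact hz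
  have hd : (1 - 3 * ((c - 1) / c ^ 2) + ((c - 1) / c ^ 2) ^ 2) *
      (1 - 5 * ((c - 1) / c ^ 2) + 4 * ((c - 1) / c ^ 2) ^ 2 +
        (1 - 3 * ((c - 1) / c ^ 2)) * (1 - 2 * ((c - 1) / c ^ 2) * c)) =
      2 / c ^ 8 * ((2 - c) * (c ^ 4 - 3 * c ^ 3 + 4 * c ^ 2 - 2 * c + 1)) := by
    field_simp
    ring
  rw [hd]
  have : (c - 1) / c ^ 2 * e * (2 / c ^ 8 *
      ((2 - c) * (c ^ 4 - 3 * c ^ 3 + 4 * c ^ 2 - 2 * c + 1))) =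
      (c - 1) / c ^ 2 * (2 / c ^ 8) * (2 * c ^ 9 - 9 * c ^ 8 + 17 * c ^ 7 - 16 * c ^ 6 +
        6 * c ^ 5 + 2 * c ^ 4 - 3 * c ^ 3 + 2 * c ^ 2) := by
    linear_combination (c - 1) / c ^ 2 * (2 / c ^ 8) * h
  rw [this]
  field_simp
  ring

theorem genFun_eq_div : genFun (Av {p1234, p2341}) = numer * denom⁻¹ := by
  rw [PowerSeries.eq_mul_inv_iff_mul_eq (by rw [constantCoeff_denom]; norm_num)]
  exact genFun_mul_denom

theorem isAlgebraic_genFun : IsAlgebraic (Polynomial ℚ) (genFun (Av {p1234, p2341})) := by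
  set φ : Polynomial ℚ →+* ℚ⟦X⟧ := algebraMap _ _
  have hX : φ Polynomial.X = X := Polynomial.coe_X
  have hp : ∀ p, IsAlgebraic (Polynomial ℚ) (φ p) := isAlgebraic_algebraMap
  have hs : IsAlgebraic (Polynomial ℚ) sqrtOneSubFour := by
    refine IsAlgebraic.of_pow (n := 2) two_pos ?_
    rw [sqrtOneSubFour_sq]
    have h1 := hp (1 - 4 * Polynomial.X)
    rwa [map_sub, map_mul, map_one, map_ofNat, hX] at h1
  have hd : IsAlgebraic (Polynomial ℚ) denom := by
    have h1 := (hp (1 - 3 * Polynomial.X + Polynomial.X ^ 2)).mul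
      ((hp (1 - 5 * Polynomial.X + 4 * Polynomial.X ^ 2)).add
        ((hp (1 - 3 * Polynomial.X)).mul hs))
    simp only [map_add, map_sub, map_mul, map_pow, map_one, map_ofNat, hX] at h1
    exact h1
  have hn : IsAlgebraic (Polynomial ℚ) numer := by
    have h1 := (hp (2 - 10 * Polynomial.X + 9 * Polynomial.X ^ 2 + 7 * Polynomial.X ^ 3 -
      4 * Polynomial.X ^ 4)).sub
        ((hp (2 - 8 * Polynomial.X + 9 * Polynomial.X ^ 2 - 3 * Polynomial.X ^ 3)).mul hs)
    simp only [map_add, map_sub, map_mul, map_pow, map_ofNat, hX] at h1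
    exact h1
  rw [← genFun_mul_denom, mul_comm] at hn
  refine hd.of_mul (mem_nonZeroDivisors_of_ne_zero (ne_zero_of_constantCoeff ?_)) hn
  rw [constantCoeff_denom]
  norm_num

/-! ### The growth rate. -/

/-- The power series whose `n`-th coefficient is, for some `K` and `j`, at most `K * (n + 1) ^ j * 4 ^ n`. -/
def fourBounded : Subring ℚ⟦X⟧ where
  carrier := {a | ∃ (K : ℚ) (j : ℕ), ∀ n, |coeff n a| ≤ K * (n + 1) ^ j * 4 ^ n}
  mul_mem' := by
    rintro a b ⟨K, i, ha⟩ ⟨L, j, hb⟩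
    -- The extra `1` pays for the `n + 1` terms of the convolution.
    refine ⟨K * L, i + j + 1, fun n => ?_⟩
    rw [coeff_mul]
    refine (Finset.abs_sum_le_sum_abs _ _).trans ?_
    have hK : 0 ≤ K := by simpa using (abs_nonneg _).trans (ha 0)
    have hL : 0 ≤ L := by simpa using (abs_nonneg _).trans (hb 0)
    have : ∀ p ∈ Finset.HasAntidiagonal.antidiagonal n, |coeff p.1 a * coeff p.2 b| ≤
        K * L * (n + 1) ^ (i + j) * 4 ^ n := fun p hp => by
      rw [Finset.HasAntidiagonal.mem_antidiagonal] at hp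
      have h1 : (p.1 : ℚ) ≤ n := by exact_mod_cast (by omega : p.1 ≤ n)
      have h2 : (p.2 : ℚ) ≤ n := by exact_mod_cast (by omega : p.2 ≤ n)
      calc |coeff p.1 a * coeff p.2 b| = |coeff p.1 a| * |coeff p.2 b| := abs_mul _ _
        _ ≤ (K * (p.1 + 1) ^ i * 4 ^ p.1) * (L * (p.2 + 1) ^ j * 4 ^ p.2) :=
          mul_le_mul (ha _) (hb _) (abs_nonneg _) (by positivity)
        _ ≤ (K * (n + 1) ^ i * 4 ^ p.1) * (L * (n + 1) ^ j * 4 ^ p.2) := by gcongr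
        _ = K * L * (n + 1) ^ (i + j) * 4 ^ n := by rw [← hp]; ring
    refine (Finset.sum_le_card_nsmul _ _ _ this).trans_eq ?_
    rw [Finset.Nat.card_antidiagonal, nsmul_eq_mul]
    push_cast
    ring
  one_mem' := ⟨1, 0, fun n => by
    rw [coeff_one]
    split_ifs with h
    · simp [h]
    · simp⟩
  add_mem' := by
    rintro a b ⟨K, i, ha⟩ ⟨L, j, hb⟩
    refine ⟨K + L, i + j, fun n => ?_⟩
    have hK : 0 ≤ K := by simpa using (abs_nonneg _).trans (ha 0)
    have hL : 0 ≤ L := by simpa using (abs_nonneg _).trans (hb 0)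
    have hn : (1 : ℚ) ≤ n + 1 := by simp
    rw [map_add]
    calc |coeff n a + coeff n b| ≤ |coeff n a| + |coeff n b| := abs_add_le _ _
      _ ≤ K * (n + 1) ^ i * 4 ^ n + L * (n + 1) ^ j * 4 ^ n := add_le_add (ha n) (hb n)
      _ ≤ K * (n + 1) ^ (i + j) * 4 ^ n + L * (n + 1) ^ (i + j) * 4 ^ n := by
        gcongr <;> first | exact hn | omega
      _ = (K + L) * (n + 1) ^ (i + j) * 4 ^ n := by ring
  zero_mem' := ⟨0, 0, fun n => by simp⟩
  neg_mem' := by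
    rintro a ⟨K, i, ha⟩
    exact ⟨K, i, fun n => by simpa using ha n⟩

theorem mem_fourBounded_of_le {a : ℚ⟦X⟧} (h : ∀ n, |coeff n a| ≤ 4 ^ n) : a ∈ fourBounded :=
  ⟨1, 0, fun n => by simpa using h n⟩

theorem catalan_le_four_pow (n : ℕ) : catalan n ≤ 4 ^ n := by
  rw [catalan_eq_centralBinom_div]
  exact (Nat.div_le_self _ _).trans (Nat.centralBinom_le_four_pow n)

theorem fib_two_mul_add_two_le (n : ℕ) : Nat.fib (2 * n + 2) ≤ 4 ^ n := by
  induction n with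
  | zero => simp
  | succ n ih =>
    have h1 := Nat.fib_add_two (n := 2 * n + 2)
    have h2 := Nat.fib_add_two (n := 2 * n + 1)
    have h3 := Nat.fib_mono (show 2 * n + 1 ≤ 2 * n + 2 by omega)
    rw [show 2 * (n + 1) + 2 = 2 * n + 2 + 2 by ring, pow_succ]
    rw [show 2 * n + 1 + 2 = 2 * n + 2 + 1 by ring, show 2 * n + 1 + 1 = 2 * n + 2 by ring] at h2
    omega

theorem one_sub_four_mul_mk : (1 - 4 * X : ℚ⟦X⟧) * (PowerSeries.mk fun n => (4 : ℚ) ^ n) = 1 := by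
  set g : ℚ⟦X⟧ := PowerSeries.mk fun n => (4 : ℚ) ^ n with hg
  ext n
  rw [sub_mul, one_mul, mul_assoc, ← map_ofNat (PowerSeries.C (R := ℚ)), map_sub, coeff_C_mul]
  cases n with
  | zero => simp [hg]
  | succ n => simp [hg, coeff_succ_X_mul, coeff_one, pow_succ]; ring

theorem one_sub_three_mul_mk_fib : (1 - 3 * X + X ^ 2 : ℚ⟦X⟧) *
    (PowerSeries.mk fun n => (Nat.fib (2 * n + 2) : ℚ)) = 1 := by
  set f : ℚ⟦X⟧ := PowerSeries.mk fun n => (Nat.fib (2 * n + 2) : ℚ) with hf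
  ext n
  rw [show (1 - 3 * X + X ^ 2) * f = f - 3 * (X * f) + X * (X * f) by ring,
    ← map_ofNat (PowerSeries.C (R := ℚ)), map_add, map_sub, coeff_C_mul]
  rcases n with _ | _ | n
  · simp [hf]
  · simp [hf, coeff_succ_X_mul, coeff_one, show Nat.fib 4 = 3 from rfl]
  · simp only [hf, coeff_succ_X_mul, coeff_one, coeff_mk]
    have h1 : Nat.fib (2 * n + 4 + 2) = Nat.fib (2 * n + 4) + Nat.fib (2 * n + 4 + 1) :=
      Nat.fib_add_two
    have h2 : Nat.fib (2 * n + 4 + 1) = Nat.fib (2 * n + 3) + Nat.fib (2 * n + 4) :=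
      Nat.fib_add_two
    have h3 : Nat.fib (2 * n + 4) = Nat.fib (2 * n + 2) + Nat.fib (2 * n + 3) :=
      Nat.fib_add_two
    rw [show 2 * (n + 1 + 1) + 2 = 2 * n + 4 + 2 by ring,
      show 2 * (n + 1) + 2 = 2 * n + 4 by ring]
    have : (Nat.fib (2 * n + 4 + 2) : ℤ) - 3 * Nat.fib (2 * n + 4) + Nat.fib (2 * n + 2) = 0 := by
      omega
    have : (Nat.fib (2 * n + 4 + 2) : ℚ) - 3 * Nat.fib (2 * n + 4) + Nat.fib (2 * n + 2) = 0 := by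
      exact_mod_cast this
    simpa using this

/-- Since `1 - X * C` is the inverse of `C`, multiplying by its powers turns `2 - C` into `1 - 2 * X
* C`, a square root of `1 - 4 * X`, and the quartic into `1 - 3 * X + X ^ 2`. -/
theorem catalanQ_denominator_mul : (1 - 2 * X * C) * (1 - X * C) ^ 5 *
    ((2 - C) * (C ^ 4 - 3 * C ^ 3 + 4 * C ^ 2 - 2 * C + 1)) =
      (1 - 4 * X) * (1 - 3 * X + X ^ 2) := by
  have h1 : (1 - 2 * X * C) ^ 2 = 1 - 4 * X := by
    rw [← sqrtOneSubFour_eq, sqrtOneSubFour_sq]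
  have h2 : (1 - X * C) * C = 1 := by rw [mul_comm, catalanQ_mul_one_sub]
  have h3 : (1 - X * C) * (2 - C) = 1 - 2 * X * C := by
    linear_combination X_mul_catalanQ_sq
  have h4 : (1 - X * C) ^ 4 * (C ^ 4 - 3 * C ^ 3 + 4 * C ^ 2 - 2 * C + 1) =
      1 - 3 * X + X ^ 2 := by
    have ht : (1 - X * C) ^ 2 = (1 - X * C) - X := by
      linear_combination X * X_mul_catalanQ_sq
    generalize 1 - X * C = t at h2 ht ⊢
    calc t ^ 4 * (C ^ 4 - 3 * C ^ 3 + 4 * C ^ 2 - 2 * C + 1) = (t * C) ^ 4 -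
        3 * t * (t * C) ^ 3 + 4 * t ^ 2 * (t * C) ^ 2 - 2 * t ^ 3 * (t * C) + t ^ 4 := by ring
      _ = 1 - 3 * X + X ^ 2 := by
        rw [h2]
        linear_combination (t ^ 2 - t + 3 - X) * ht
  rw [← h1, ← h4]
  calc (1 - 2 * X * C) * (1 - X * C) ^ 5 *
      ((2 - C) * (C ^ 4 - 3 * C ^ 3 + 4 * C ^ 2 - 2 * C + 1)) =
      (1 - 2 * X * C) * ((1 - X * C) * (2 - C)) * ((1 - X * C) ^ 4 *
        (C ^ 4 - 3 * C ^ 3 + 4 * C ^ 2 - 2 * C + 1)) := by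
        generalize 1 - X * C = t
        ring
    _ = _ := by rw [h3]; generalize 1 - 2 * X * C = r; ring

theorem labelSeries_dec_one_mem : labelSeries (.dec 1) ∈ fourBounded := by
  have hC : C ∈ fourBounded := mem_fourBounded_of_le fun n => by
    rw [catalanQ, coeff_map, catalanSeries_coeff]
    simpa using (by exact_mod_cast catalan_le_four_pow n : (catalan n : ℚ) ≤ 4 ^ n)
  have hX : (X : ℚ⟦X⟧) ∈ fourBounded := mem_fourBounded_of_le fun n => by
    rw [coeff_X]
    split_ifs with h
    · simp [h]
    · simp
  set g : ℚ⟦X⟧ := PowerSeries.mk fun n => (4 : ℚ) ^ n with hg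
  set f : ℚ⟦X⟧ := PowerSeries.mk fun n => (Nat.fib (2 * n + 2) : ℚ) with hf
  have hgm : g ∈ fourBounded := mem_fourBounded_of_le fun n => by simp [hg]
  have hfm : f ∈ fourBounded := mem_fourBounded_of_le fun n => by
    rw [hf, coeff_mk, Nat.abs_cast]
    exact_mod_cast fib_two_mul_add_two_le n
  have key : labelSeries (.dec 1) = (1 - 2 * X * C) * (1 - X * C) ^ 5 *
      (2 * C ^ 9 - 9 * C ^ 8 + 17 * C ^ 7 - 16 * C ^ 6 + 6 * C ^ 5 + 2 * C ^ 4 - 3 * C ^ 3 +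
        2 * C ^ 2) * g * f := by
    rw [← labelSeries_dec_one_mul]
    have h1 := catalanQ_denominator_mul
    generalize (1 - 2 * X * C) * (1 - X * C) ^ 5 = r at h1 ⊢
    generalize (2 - C) * (C ^ 4 - 3 * C ^ 3 + 4 * C ^ 2 - 2 * C + 1) = s at h1 ⊢
    linear_combination (-labelSeries (.dec 1)) * one_sub_three_mul_mk_fib -
      labelSeries (.dec 1) * (1 - 3 * X + X ^ 2) * f * one_sub_four_mul_mk -
      labelSeries (.dec 1) * g * f * h1
  have hN : ∀ k : ℕ, (k : ℚ⟦X⟧) ∈ fourBounded := natCast_mem fourBounded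
  rw [key]
  refine mul_mem (mul_mem (mul_mem (mul_mem ?_ (pow_mem ?_ _)) ?_) hgm) hfm
  · exact sub_mem (one_mem _) (mul_mem (mul_mem (hN 2) hX) hC)
  · exact sub_mem (one_mem _) (mul_mem hX hC)
  · have hm : ∀ k j : ℕ, (k : ℚ⟦X⟧) * C ^ j ∈ fourBounded := fun k j =>
      mul_mem (hN k) (pow_mem hC j)
    exact add_mem (sub_mem (add_mem (add_mem (sub_mem (add_mem (sub_mem (hm 2 9) (hm 9 8))
      (hm 17 7)) (hm 16 6)) (hm 6 5)) (hm 2 4)) (hm 3 3)) (hm 2 2)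

/-- From `C ^ (k + 2) = C ^ (k + 1) + X * C ^ (k + 3)`, the coefficients can only grow with the
exponent. -/
theorem coeff_catalanQ_le_pow (k n : ℕ) : coeff n C ≤ coeff n (C ^ (k + 1)) ∧
    ∀ m, 0 ≤ coeff m (C ^ (k + 1)) := by
  have hC : ∀ m, coeff m C = catalan m := fun m => by
    rw [catalanQ, coeff_map, catalanSeries_coeff]
    rfl
  induction k generalizing n with
  | zero =>
    rw [zero_add, pow_one]
    exact ⟨le_rfl, fun m => by rw [hC]; positivity⟩
  | succ k ih =>
    have h : C ^ (k + 1 + 1) = C ^ (k + 1) + X * (C ^ (k + 1) * C ^ 2) := by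
      linear_combination -C ^ (k + 1) * X_mul_catalanQ_sq
    have hp : ∀ m, 0 ≤ coeff m (C ^ (k + 1 + 1)) := fun m => by
      rw [pow_succ, coeff_mul]
      refine Finset.sum_nonneg fun p _ => mul_nonneg ((ih 0).2 _) ?_
      rw [hC]
      positivity
    have hp' : ∀ m, 0 ≤ coeff m (C ^ (k + 1) * C ^ 2) := fun m => by
      rw [show C ^ (k + 1) * C ^ 2 = C ^ (k + 1 + 1) * C by ring, coeff_mul]
      refine Finset.sum_nonneg fun p _ => mul_nonneg (hp _) ?_
      rw [hC]
      positivity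
    refine ⟨(ih n).1.trans ?_, hp⟩
    rw [h, map_add]
    refine le_add_of_nonneg_right ?_
    cases n with
    | zero => simp
    | succ n => rw [coeff_succ_X_mul]; exact hp' n

theorem catalan_le_labelCount (d : ℕ) : catalan d ≤ labelCount d (.gen false 1 0 1) := by
  have h := labelSeries_gen_false_zero 1 1
  have h1 := (coeff_catalanQ_le_pow 3 d).1
  dsimp only at h
  rw [show 3 + 1 = 1 + 1 + 2 by rfl, ← h, labelSeries, coeff_mk, catalanQ, coeff_map,
    catalanSeries_coeff, eq_natCast] at h1
  exact_mod_cast h1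

theorem catalan_le_count (d : ℕ) : catalan d ≤ count (Av {p1234, p2341}) (d + 4) := by
  rw [count_eq_labelCount]
  refine (catalan_le_labelCount d).trans ?_
  -- The path is `dec 0`, `dec 1`, `mid true 0 0`, `mid false 0 1`, `gen false 1 0 1`; the last node
  -- has series `C ^ 4`.
  simp [labelCount]
  omega

theorem count_le : ∃ (K : ℝ) (j : ℕ), 0 < K ∧ ∀ n : ℕ,
    (count (Av {p1234, p2341}) n : ℝ) ≤ K * (n + 1) ^ j * 4 ^ n := by
  obtain ⟨K, j, h⟩ := mul_mem (show (X : ℚ⟦X⟧) ∈ fourBounded from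
    mem_fourBounded_of_le fun n => by
      rw [coeff_X]
      split_ifs with h
      · simp [h]
      · simp) labelSeries_dec_one_mem
  rw [← genFun_eq] at h
  refine ⟨max K 1, j, by positivity, fun n => ?_⟩
  have h1 := h n
  rw [genFun, coeff_mk, Nat.abs_cast] at h1
  have h2 : (count (Av {p1234, p2341}) n : ℝ) ≤ K * (n + 1) ^ j * 4 ^ n := by exact_mod_cast h1
  refine h2.trans ?_
  gcongr
  exact le_max_left _ _

/-- The constant is `2 * 4 ^ 4`: the `4 ^ 4` makes up for the depth `4`, the `2` comes from the
central binomial bound, which needs `n - 4 > 0`. -/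
theorem four_pow_le_count {n : ℕ} (hn : 5 ≤ n) :
    (4 : ℝ) ^ n ≤ 512 * (n + 1) ^ 2 * count (Av {p1234, p2341}) n := by
  obtain ⟨d, rfl⟩ : ∃ d, n = d + 4 := ⟨n - 4, by omega⟩
  have h1 := Nat.four_pow_le_two_mul_self_mul_centralBinom d (by omega)
  have h2 := succ_mul_catalan_eq_centralBinom d
  have h3 := catalan_le_count d
  have h4 : 4 ^ (d + 4) ≤ 512 * (d + 4 + 1) ^ 2 * count (Av {p1234, p2341}) (d + 4) := by
    calc 4 ^ (d + 4) = 256 * 4 ^ d := by ring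
      _ ≤ 256 * (2 * d * ((d + 1) * catalan d)) := by rw [h2]; gcongr
      _ = 512 * (d * (d + 1)) * catalan d := by ring
      _ ≤ 512 * ((d + 4 + 1) * (d + 4 + 1)) * count (Av {p1234, p2341}) (d + 4) := by
        gcongr <;> omega
      _ = _ := by ring
  exact_mod_cast h4

theorem tendsto_const_mul_pow_rpow {K : ℝ} (hK : 0 < K) (j : ℕ) :
    Tendsto (fun n : ℕ => (K * ((n : ℝ) + 1) ^ j) ^ (1 / (n : ℝ))) atTop (𝓝 1) := by
  have h1 : Tendsto (fun n : ℕ => K ^ (1 / (n : ℝ))) atTop (𝓝 1) := by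
    have := (tendsto_const_nhds (x := K)).rpow tendsto_one_div_atTop_nhds_zero_nat
      (Or.inl hK.ne')
    simpa using this
  have h2 : Tendsto (fun n : ℕ => ((n : ℝ) + 1) ^ (1 / (n : ℝ))) atTop (𝓝 1) := by
    -- With `x = n + 1`, the exponent `1 / (x - 1)` is `1 / n`.
    have := (tendsto_rpow_div_mul_add 1 1 (-1) zero_ne_one).comp
      (tendsto_atTop_add_const_right _ 1 (tendsto_natCast_atTop_atTop (R := ℝ)))
    refine this.congr fun n => ?_
    simp
  have h3 := h1.mul (h2.pow j)
  rw [one_pow, one_mul] at h3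
  refine h3.congr fun n => ?_
  rw [Real.mul_rpow hK.le (by positivity), ← Real.rpow_natCast, ← Real.rpow_natCast,
    ← Real.rpow_mul (by positivity), ← Real.rpow_mul (by positivity), mul_comm (j : ℝ)]

theorem hasGrowthRate_four : HasGrowthRate (Av {p1234, p2341}) 4 := by
  obtain ⟨K, j, hK, h⟩ := count_le
  have hup := (tendsto_const_mul_pow_rpow hK j).mul_const 4
  have hlow := ((tendsto_const_mul_pow_rpow (K := 512) (by norm_num) 2).inv₀ one_ne_zero).mul_const 4
  rw [one_mul] at hup
  rw [inv_one, one_mul] at hlow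
  have h4 : ∀ n : ℕ, n ≠ 0 → ((4 : ℝ) ^ n) ^ (1 / (n : ℝ)) = 4 := fun n hn => by
    rw [one_div, Real.pow_rpow_inv_natCast (by norm_num) hn]
  refine tendsto_of_tendsto_of_tendsto_of_le_of_le' hlow hup ?_ ?_
  · filter_upwards [eventually_ge_atTop 5] with n hn
    rw [inv_mul_le_iff₀ (by positivity), ← Real.mul_rpow (by positivity) (by positivity)]
    have := Real.rpow_le_rpow (by positivity) (four_pow_le_count hn)
      (show 0 ≤ 1 / (n : ℝ) by positivity)
    rwa [h4 n (by omega)] at this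
  · filter_upwards [eventually_ge_atTop 1] with n hn
    refine (Real.rpow_le_rpow (by positivity) (h n) (by positivity)).trans_eq ?_
    rw [Real.mul_rpow (by positivity) (by positivity), h4 n (by omega)]

end series

end PermPattern

theorem mainTheorem8 :
    PermPattern.genFun (PermPattern.Av {PermPattern.p1234, PermPattern.p2341})
        = PermPattern.numer * PermPattern.denom⁻¹ ∧
      IsAlgebraic (Polynomial ℚ)
        (PermPattern.genFun (PermPattern.Av {PermPattern.p1234, PermPattern.p2341})) ∧
      PermPattern.HasGrowthRate (PermPattern.Av {PermPattern.p1234, PermPattern.p2341}) 4 :=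
  ⟨PermPattern.genFun_eq_div, PermPattern.isAlgebraic_genFun, PermPattern.hasGrowthRate_four⟩
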